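/- Let $\Bbbk=\mathbb R$ or $\mathbb C$, let $M$ be a smooth manifold and let $\pi:V\to M$ be a smooth $\Bbbk$-vector bundle with standard fibre $\Bbbk^k$. A \emph{connection} on a smooth fibre bundle $p:F\to M$ is (given by) a smooth fibrewise linear projection $P_V:TF\to TF$ over $F$ with image the vertical bundle $VF=\ker Tp$. An \emph{affine connection} on $V$ is a connection $P_V$ on $\pi$ that is also $\Bbbk$-linear on the fibres of the vector bundle $T\pi:TV\to TM$. The \emph{frame bundle} $\pi':\mathcal F(V)\to M$ is the open subbundle of $\mathrm{Hom}(\Bbbk^k\times M,V)$ consisting of the linear isomorphisms $f:\Bbbk^k\to V_m$, $m\in M$, with right action $\rho_g(f)=f\circ g$ of $g\in GL(\Bbbk^k)$; a \emph{principal connection} on it is a connection $P$ on $\pi'$ with $P\circ T\rho_g=T\rho_g\circ P$ for all $g$. The associated bundle is the quotient $q:\mathcal F(V)\times\Bbbk^k\to\mathcal F(V)[\lambda]=(\mathcal F(V)\times\Bbbk^k)/GL(\Bbbk^k)$ by the right action $(f,u)\cdot g=(f\circ g,g^{-1}u)$, and $\theta:\mathcal F(V)[\lambda]\to V$, $[f,u]\mapsto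 f(u)$, is the natural map. Then $q$ is a smooth submersion, $\theta$ is a diffeomorphism, and for every principal connection $P$ on $\mathcal F(V)$ there is exactly one connection $P[\lambda]$ on $\mathcal F(V)[\lambda]\to M$ (the \emph{induced connection}) with $P[\lambda]\circ Tq=Tq\circ(P\times\mathrm{id}_{T\Bbbk^k})$. Moreover there is exactly one bijection $\Phi$ from the set of affine connections on $V$ onto the set of principal connections on $\mathcal F(V)$ whose inverse is given by the induced connection under the identification $\theta$, that is, such that $$\Phi^{-1}(P)\circ T\theta=T\theta\circ P[\lambda]$$ for every principal connection $P$ on $\mathcal F(V)$. -/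

import Mathlib

open Bundle Set Topology
open scoped Manifold ContDiff Bundle

set_option linter.unusedSectionVars false

noncomputable section

namespace FrameConn

section Generic
variable {𝕜 : Type*} [RCLike 𝕜] {E : Type*} [NormedAddCommGroup E] [NormedSpace ℝ E]
  {H : Type*} [TopologicalSpace H] (I : ModelWithCorners ℝ E H)
  {M : Type*} [TopologicalSpace M] [ChartedSpace H M]
  {F : Type*} [NormedAddCommGroup F] [NormedSpace 𝕜 F] [NormedSpace ℝ F] [IsScalarTower ℝ 𝕜 F]
  [FiniteDimensional ℝ F]
  {V : M → Type*} [∀ x, AddCommGroup (V x)] [∀ x, Module 𝕜 (V x)] [∀ x, Module ℝ (V x)]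
  [∀ x, IsScalarTower ℝ 𝕜 (V x)] [∀ x, TopologicalSpace (V x)]
  [∀ x, IsTopologicalAddGroup (V x)] [∀ x, ContinuousSMul 𝕜 (V x)] [∀ x, ContinuousSMul ℝ (V x)]
  [TopologicalSpace (TotalSpace F V)] [FiberBundle F V] [VectorBundle 𝕜 F V] [VectorBundle ℝ F V]

variable (𝕜 F) in
theorem exists_extend : ∃ L : (F →L[ℝ] F) →L[ℝ] (F →L[𝕜] F),
    ∀ (A : F →L[𝕜] F) (B : F →L[ℝ] F), (∀ v, B v = A v) → L B = A := by
  have hinj : Function.Injective (ContinuousLinearMap.restrictScalarsₗ 𝕜 F F ℝ ℝ) :=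
    fun A B h => by ext v; exact congrArg (fun C : F →L[ℝ] F => C v) h
  obtain ⟨L, hL⟩ := LinearMap.exists_leftInverse_of_injective _ (LinearMap.ker_eq_bot.2 hinj)
  refine ⟨LinearMap.toContinuousLinearMap L, fun A B h => ?_⟩
  have : B = ContinuousLinearMap.restrictScalarsₗ 𝕜 F F ℝ ℝ A := by ext v; exact h v
  rw [this]
  exact LinearMap.congr_fun hL A

theorem coordChange_eq (e e' : Trivialization F (π F V))
    [MemTrivializationAtlas e] [MemTrivializationAtlas e'] :
    ∃ L : (F →L[ℝ] F) →L[ℝ] (F →L[𝕜] F), ∀ b ∈ e.baseSet ∩ e'.baseSet,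
      L (e.coordChangeL ℝ e' b : F →L[ℝ] F) = (e.coordChangeL 𝕜 e' b : F →L[𝕜] F) := by
  obtain ⟨L, hL⟩ := exists_extend 𝕜 F
  refine ⟨L, fun b hb => hL _ _ fun v => ?_⟩
  simp only [ContinuousLinearEquiv.coe_coe]
  rw [Trivialization.coordChangeL_apply _ _ hb, Trivialization.coordChangeL_apply _ _ hb]

theorem contDiff_of_linear {X Y : Type*} [NormedAddCommGroup X] [NormedSpace ℝ X]
    [FiniteDimensional ℝ X] [NormedAddCommGroup Y] [NormedSpace ℝ Y] (f : X → Y)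
    (ha : ∀ x y, f (x + y) = f x + f y) (hs : ∀ (c : ℝ) x, f (c • x) = c • f x) :
    ContDiff ℝ ∞ f :=
  (LinearMap.toContinuousLinearMap
    ({ toFun := f, map_add' := ha, map_smul' := hs } : X →ₗ[ℝ] Y)).contDiff

variable (𝕜 F) in
theorem homFinite : FiniteDimensional ℝ (F →L[𝕜] F) :=
  Module.Finite.of_injective (ContinuousLinearMap.restrictScalarsₗ 𝕜 F F ℝ ℝ)
    fun A B h => by ext v; exact congrArg (fun C : F →L[ℝ] F => C v) h

variable (𝕜 F) in
theorem postcomp : ∃ T : (F →L[𝕜] F) →L[ℝ] (F →L[𝕜] F) →L[ℝ] (F →L[𝕜] F),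
    ∀ A B, T A B = A.comp B :=
  ⟨ContinuousLinearMap.mul ℝ (F →L[𝕜] F), fun _ _ => rfl⟩

instance trivialMem : MemTrivializationAtlas (Bundle.Trivial.trivialization M F) := ⟨rfl⟩

variable (𝕜) in
/-- The trivialization of `Hom(F × M, V)` induced by a trivialization of `V`. -/
def homTriv (e : Trivialization F (π F V)) [MemTrivializationAtlas e] :
    Trivialization (F →L[𝕜] F)
      (π (F →L[𝕜] F) (fun x => Bundle.Trivial M F x →L[𝕜] V x)) :=
  Trivialization.continuousLinearMap (RingHom.id 𝕜) (Bundle.Trivial.trivialization M F) e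

theorem homTriv_baseSet (e : Trivialization F (π F V)) [MemTrivializationAtlas e] :
    (homTriv 𝕜 e).baseSet = e.baseSet := by
  simp [homTriv, Bundle.Trivial.trivialization]

theorem homTriv_apply (e : Trivialization F (π F V)) [MemTrivializationAtlas e]
    (p : TotalSpace (F →L[𝕜] F) (fun x => Bundle.Trivial M F x →L[𝕜] V x)) (hp : p.1 ∈ e.baseSet)
    (v : F) : (homTriv 𝕜 e p).2 v = (e ⟨p.1, p.2 v⟩).2 := by
  rw [homTriv, Trivialization.continuousLinearMap_apply]
  simp [Trivialization.linearMapAt_apply, hp]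

theorem exists_of_mem_atlas
    (e : Trivialization (F →L[𝕜] F)
      (π (F →L[𝕜] F) (fun x => Bundle.Trivial M F x →L[𝕜] V x))) [h : MemTrivializationAtlas e] :
    ∃ (e₂ : Trivialization F (π F V)) (_ : MemTrivializationAtlas e₂), e = homTriv 𝕜 e₂ := by
  obtain ⟨_, ⟨e₁, e₂, h₁, h₂, rfl⟩, rfl⟩ := h.out
  obtain rfl := Bundle.Trivial.eq_trivialization M F e₁
  exact ⟨e₂, h₂, rfl⟩

instance homIsLinear (e : Trivialization F (π F V)) [MemTrivializationAtlas e] :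
    (homTriv 𝕜 e).IsLinear ℝ where
  linear x hx := by
    rw [homTriv_baseSet] at hx
    constructor
    · intro A B
      ext v
      have := (Trivialization.linear 𝕜 e hx).map_add (A v) (B v)
      rw [add_apply, homTriv_apply e _ hx, homTriv_apply e _ hx,
        homTriv_apply e _ hx]
      exact this
    · intro c A
      ext v
      have := (Trivialization.linear ℝ e hx).map_smul c (A v)
      rw [smul_apply, homTriv_apply e _ hx, homTriv_apply e _ hx]
      exact this

theorem homCoord (e e' : Trivialization F (π F V))
    [MemTrivializationAtlas e] [MemTrivializationAtlas e'] {b : M}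
    (hb : b ∈ e.baseSet ∩ e'.baseSet) :
    ((homTriv 𝕜 e).coordChangeL ℝ (homTriv 𝕜 e') b : (F →L[𝕜] F) →L[ℝ] (F →L[𝕜] F)) =
    (postcomp 𝕜 F).choose (e.coordChangeL 𝕜 e' b : F →L[𝕜] F) := by
  have hb' : b ∈ (homTriv 𝕜 e).baseSet ∩ (homTriv 𝕜 e').baseSet := by
    rwa [homTriv_baseSet, homTriv_baseSet]
  ext A v
  rw [(postcomp 𝕜 F).choose_spec]
  change _ = e.coordChangeL 𝕜 e' b (A v)
  simp only [ContinuousLinearEquiv.coe_coe]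
  rw [Trivialization.coordChangeL_apply _ _ hb', homTriv_apply e' _ hb.2,
    Trivialization.coordChangeL_apply _ _ hb]
  have h1 := homTriv_apply e ⟨b, (homTriv 𝕜 e).symm b A⟩ hb.1 v
  rw [(homTriv 𝕜 e).apply_mk_symm hb'.1] at h1
  congr 2
  change (⟨b, (homTriv 𝕜 e).symm b A v⟩ : TotalSpace F V) = _
  apply e.injOn
  · rw [e.mem_source]; exact hb.1
  · rw [e.mem_source]; exact hb.1
  exact (Prod.ext (e.coe_fst' hb.1) h1.symm :
    e ⟨b, (homTriv 𝕜 e).symm b A v⟩ = (b, A v)).trans (e.apply_mk_symm hb.1 _).symm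

instance homVectorBundleReal :
    VectorBundle ℝ (F →L[𝕜] F) (fun x => Bundle.Trivial M F x →L[𝕜] V x) where
  trivialization_linear' e he := by
    obtain ⟨e₂, h₂, rfl⟩ := exists_of_mem_atlas e
    infer_instance
  continuousOn_coordChange' e e' he he' := by
    obtain ⟨e, h, rfl⟩ := exists_of_mem_atlas e
    obtain ⟨e', h', rfl⟩ := exists_of_mem_atlas e'
    rw [homTriv_baseSet, homTriv_baseSet]
    exact (((postcomp 𝕜 F).choose).continuous.comp_continuousOn
      (continuousOn_coordChange 𝕜 e e')).congr fun b hb => homCoord e e' hb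

set_option synthInstance.maxHeartbeats 200000 in
instance homContMDiff [ContMDiffVectorBundle ∞ F V I] :
   ContMDiffVectorBundle ∞ (F →L[𝕜] F) (fun x => Bundle.Trivial M F x →L[𝕜] V x) I where
  contMDiffOn_coordChangeL e e' he he' := by
    obtain ⟨e, h, rfl⟩ := exists_of_mem_atlas e
    obtain ⟨e', h', rfl⟩ := exists_of_mem_atlas e'
    obtain ⟨L, hL⟩ := coordChange_eq (𝕜 := 𝕜) e e'
    rw [homTriv_baseSet, homTriv_baseSet]
    have := homFinite 𝕜 F
    have h1 := contMDiffOn_coordChangeL (IB := I) (n := ∞) e e' 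
    have h2 : ContDiff ℝ ∞ L := L.contDiff
    have h3 : ContDiff ℝ ∞ ((postcomp 𝕜 F).choose) :=
      contDiff_of_linear _ (map_add _) (map_smul _)
    refine ((h3.comp h2).contMDiff.comp_contMDiffOn h1).congr fun b hb => ?_
    rw [homCoord e e' hb, ← hL b hb]
    rfl


theorem homTriv_eq_comp (e : Trivialization F (π F V)) [MemTrivializationAtlas e]
    (p : TotalSpace (F →L[𝕜] F) (fun x => Bundle.Trivial M F x →L[𝕜] V x)) (hp : p.1 ∈ e.baseSet) :
    Function.Bijective (homTriv 𝕜 e p).2 ↔ Function.Bijective p.2 := by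
  have : ((homTriv 𝕜 e p).2 : F → F) = e.continuousLinearEquivAt 𝕜 p.1 hp ∘ p.2 := by
    ext v
    exact homTriv_apply e p hp v
  rw [this]
  exact (e.continuousLinearEquivAt 𝕜 p.1 hp).bijective.of_comp_iff' _

variable (𝕜 F V) in
theorem isOpen_frames : IsOpen {p : TotalSpace (F →L[𝕜] F)
    (fun x => Bundle.Trivial M F x →L[𝕜] V x) | Function.Bijective p.2} := by
  have : CompleteSpace F := FiniteDimensional.complete ℝ F
  rw [isOpen_iff_mem_nhds]
  intro p hp
  let e := trivializationAt F V p.1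
  have he : p.1 ∈ e.baseSet := mem_baseSet_trivializationAt F V p.1
  have hps : p ∈ (homTriv 𝕜 e).source := by
    rw [(homTriv 𝕜 e).mem_source, homTriv_baseSet]; exact he
  have hc : ContinuousAt (fun q => (homTriv 𝕜 e q).2) p :=
    continuous_snd.continuousAt.comp ((homTriv 𝕜 e).continuousAt hps)
  have hu : {A : F →L[𝕜] F | IsUnit A} ∈ 𝓝 ((homTriv 𝕜 e p).2) :=
    Units.isOpen.mem_nhds
      (ContinuousLinearMap.isUnit_iff_bijective.2 ((homTriv_eq_comp e p he).2 hp))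
  filter_upwards [hc hu, (homTriv 𝕜 e).open_source.mem_nhds hps] with q hq hq'
  rw [(homTriv 𝕜 e).mem_source, homTriv_baseSet] at hq'
  exact (homTriv_eq_comp e q hq').1 (ContinuousLinearMap.isUnit_iff_bijective.1 hq)

variable (𝕜 F V) in
/-- The frame bundle `F^λ(V)`: the open subbundle of `Hom(F × M, V)` formed by the linear
isomorphisms `F → V_m` (`m ∈ M`). -/
def frameBundle : TopologicalSpace.Opens (TotalSpace (F →L[𝕜] F)
    (fun x => Bundle.Trivial M F x →L[𝕜] V x)) :=
  ⟨{p | Function.Bijective p.2}, isOpen_frames 𝕜 F V⟩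

variable (𝕜 F V) in
/-- The total space of the frame bundle, with the manifold structure of an open subset. -/
abbrev FrameBundle := ↥(frameBundle 𝕜 F V)

/-- The bundle projection of the frame bundle. -/
def frameProj (p : FrameBundle 𝕜 F V) : M := p.1.1

/-- The frame `p`, as a linear map from the standard fibre into the fibre of `V`. -/
def frameMap (p : FrameBundle 𝕜 F V) : F →L[𝕜] V (frameProj p) := p.1.2

theorem frameMap_bijective (p : FrameBundle 𝕜 F V) : Function.Bijective (frameMap p) := p.2

/-- The principal right action of `GL(F)` on the frame bundle: `(f, g) ↦ f ∘ g`. -/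
def frameAct (g : F ≃L[𝕜] F) (p : FrameBundle 𝕜 F V) : FrameBundle 𝕜 F V :=
  ⟨⟨frameProj p, (frameMap p).comp (g : F →L[𝕜] F)⟩, p.2.comp g.bijective⟩

variable (𝕜 F V) in
/-- The orbit relation of the right action `(p, u) · g = (p · g, g⁻¹ u)` of `GL(F)` on
`F^λ(V) × F`. -/
def assocSetoid : Setoid (FrameBundle 𝕜 F V × F) where
  r a b := ∃ g : F ≃L[𝕜] F, b = (frameAct g a.1, g⁻¹ a.2)
  iseqv := by
    refine ⟨fun a => ⟨1, rfl⟩, ?_, ?_⟩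
    · rintro a _ ⟨g, rfl⟩
      refine ⟨g⁻¹, Prod.ext ?_ ?_⟩
      · apply Subtype.ext
        change a.1.1 = ⟨a.1.1.1, (a.1.1.2.comp (g : F →L[𝕜] F)).comp ((g⁻¹ : F ≃L[𝕜] F) : F →L[𝕜] F)⟩
        rw [ContinuousLinearMap.comp_assoc]
        have : (g : F →L[𝕜] F).comp ((g⁻¹ : F ≃L[𝕜] F) : F →L[𝕜] F) = ContinuousLinearMap.id 𝕜 F := by
          ext v; exact g.apply_symm_apply v
        rw [this]
        rfl
      · exact (g.apply_symm_apply a.2).symm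
    · rintro a _ _ ⟨g, rfl⟩ ⟨h, rfl⟩
      exact ⟨g * h, rfl⟩

variable (𝕜 F V) in
/-- The associated bundle `F^λ(V)[λ] = (F^λ(V) × F) / GL(F)`, with the quotient topology. -/
def AssocBundle := Quotient (assocSetoid 𝕜 F V)

instance : TopologicalSpace (AssocBundle 𝕜 F V) :=
  inferInstanceAs (TopologicalSpace (Quotient (assocSetoid 𝕜 F V)))

/-- The quotient map `q : F^λ(V) × F → F^λ(V)[λ]`. -/
def assocMk (a : FrameBundle 𝕜 F V × F) : AssocBundle 𝕜 F V := Quotient.mk _ a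

/-- The evaluation map `F^λ(V) × F → V`, `(f, u) ↦ f(u)`. -/
def frameEval (a : FrameBundle 𝕜 F V × F) : TotalSpace F V := ⟨frameProj a.1, frameMap a.1 a.2⟩

/-- The natural map `F^λ(V)[λ] → V`, `[f, u] ↦ f(u)`. -/
def assocToFun : AssocBundle 𝕜 F V → TotalSpace F V :=
  Quotient.lift frameEval (by
    rintro a _ ⟨g, rfl⟩
    change _ = (⟨frameProj a.1, frameMap a.1 (g (g.symm a.2))⟩ : TotalSpace F V)
    rw [g.apply_symm_apply]
    rfl)

theorem continuous_frameEval : Continuous (frameEval (𝕜 := 𝕜) (F := F) (V := V)) := by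
  rw [continuous_iff_continuousAt]
  intro a
  have hp : Continuous fun a : FrameBundle 𝕜 F V × F => a.1.1 :=
    continuous_subtype_val.comp continuous_fst
  have hpr : ContinuousAt (fun a : FrameBundle 𝕜 F V × F => a.1.1.1) a :=
    ((FiberBundle.continuous_proj _ _).comp hp).continuousAt
  refine (FiberBundle.continuousAt_totalSpace F frameEval).2 ⟨hpr, ?_⟩
  let e := trivializationAt F V a.1.1.1
  have he : a.1.1.1 ∈ e.baseSet := mem_baseSet_trivializationAt F V a.1.1.1
  have hps : a.1.1 ∈ (homTriv 𝕜 e).source := by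
    rw [(homTriv 𝕜 e).mem_source, homTriv_baseSet]; exact he
  have hc : ContinuousAt (fun b : FrameBundle 𝕜 F V × F => (homTriv 𝕜 e b.1.1).2 b.2) a :=
    ContinuousAt.clm_apply (continuous_snd.continuousAt.comp
      (ContinuousAt.comp (f := fun b : FrameBundle 𝕜 F V × F => b.1.1) 
        ((homTriv 𝕜 e).continuousAt hps) hp.continuousAt))
      continuous_snd.continuousAt
  refine hc.congr ?_
  filter_upwards [hpr (e.open_baseSet.mem_nhds he)] with b hb
  exact homTriv_apply e b.1.1 hb b.2

theorem assocToFun_bijective : Function.Bijective (assocToFun (𝕜 := 𝕜) (F := F) (V := V)) := by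
  constructor
  · have : FiniteDimensional 𝕜 F := Module.Finite.of_restrictScalars_finite ℝ 𝕜 F
    rintro ⟨⟨⟨m, f⟩, hf⟩, u⟩ ⟨⟨⟨m', f'⟩, hf'⟩, u'⟩ h
    have h : (⟨m, f u⟩ : TotalSpace F V) = ⟨m', f' u'⟩ := h
    obtain rfl : m = m' := congrArg TotalSpace.proj h
    have h : f u = f' u' := TotalSpace.mk_inj.1 h
    let f₁ : F ≃ₗ[𝕜] V m := LinearEquiv.ofBijective (f : F →ₗ[𝕜] V m) hf
    let f₂ : F ≃ₗ[𝕜] V m := LinearEquiv.ofBijective (f' : F →ₗ[𝕜] V m) hf'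
    let g : F ≃L[𝕜] F := (f₂.trans f₁.symm).toContinuousLinearEquiv
    have hg : ∀ v, f (g v) = f' v := fun v => f₁.apply_symm_apply (f₂ v)
    refine Quotient.sound ⟨g, Prod.ext (Subtype.ext ?_) ?_⟩
    · change (⟨m, f'⟩ : TotalSpace (F →L[𝕜] F) (fun x => Bundle.Trivial M F x →L[𝕜] V x))
        = ⟨m, f.comp (g : F →L[𝕜] F)⟩
      congr 1
      ext v
      exact (hg v).symm
    · change u' = g.symm u
      rw [ContinuousLinearEquiv.eq_symm_apply]
      exact hf.injective ((hg u').trans h.symm)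
  · rintro ⟨m, v⟩
    let e := trivializationAt F V m
    have he : m ∈ e.baseSet := mem_baseSet_trivializationAt F V m
    let L := (e.continuousLinearEquivAt 𝕜 m he).symm
    refine ⟨assocMk (⟨⟨m, (L : F →L[𝕜] V m)⟩, L.bijective⟩, L.symm v), ?_⟩
    change (⟨m, L (L.symm v)⟩ : TotalSpace F V) = _
    rw [L.apply_symm_apply]

theorem continuousOn_inv (e : Trivialization F (π F V)) [MemTrivializationAtlas e] :
    ContinuousOn (Equiv.ofBijective _ (assocToFun_bijective (𝕜 := 𝕜) (F := F) (V := V))).symm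
      e.source := by
  rw [continuousOn_iff_continuous_domRestrict]
  have key : ∀ x : e.source, (x : TotalSpace F V).1 ∈ (homTriv 𝕜 e).baseSet := fun x => by
    rw [homTriv_baseSet]; exact e.mem_source.1 x.2
  let s : e.source → TotalSpace (F →L[𝕜] F) (fun x => Bundle.Trivial M F x →L[𝕜] V x) :=
    fun x => (homTriv 𝕜 e).toOpenPartialHomeomorph.symm (x.1.1, ContinuousLinearMap.id 𝕜 F)
  have hs : Continuous s := by
    refine (homTriv 𝕜 e).toOpenPartialHomeomorph.continuousOn_symm.comp_continuous
      (((FiberBundle.continuous_proj F V).comp continuous_subtype_val).prodMk continuous_const) ?_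
    intro x
    rw [(homTriv 𝕜 e).mem_target] 
    exact key x
  have hs1 : ∀ x, (s x).1 = x.1.1 := fun x => (homTriv 𝕜 e).proj_symm_apply' (key x)
  have hs2 : ∀ x, homTriv 𝕜 e (s x) = (x.1.1, ContinuousLinearMap.id 𝕜 F) :=
    fun x => (homTriv 𝕜 e).apply_symm_apply' (key x)
  have hsb : ∀ x, (s x).1 ∈ e.baseSet := fun x => by
    rw [hs1]; exact e.mem_source.1 x.2
  have hs3 : ∀ x, s x ∈ frameBundle 𝕜 F V := fun x => by
    refine (homTriv_eq_comp e (s x) (hsb x)).1 ?_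
    rw [hs2]
    exact Function.bijective_id
  have hc : Continuous fun x : e.source =>
      assocMk (𝕜 := 𝕜) (F := F) (V := V) (⟨s x, hs3 x⟩, (e x.1).2) := by
    refine continuous_quotient_mk'.comp ((hs.subtype_mk hs3).prodMk ?_)
    exact continuous_snd.comp (e.continuousOn.comp_continuous continuous_subtype_val fun x => x.2)
  convert hc using 1
  ext1 x
  rw [Set.domRestrict_apply, Equiv.symm_apply_eq]
  change x.1 = frameEval (⟨s x, hs3 x⟩, (e x.1).2)
  apply e.injOn x.2
  · rw [e.mem_source]; exact hsb x
  · have h1 := homTriv_apply e (s x) (hsb x) (e x.1).2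
    rw [hs2] at h1
    refine Prod.ext ?_ h1
    change (e x.1).1 = (e (frameEval (⟨s x, hs3 x⟩, (e x.1).2))).1
    rw [e.coe_fst x.2, e.coe_fst' (show (frameEval (⟨s x, hs3 x⟩, (e x.1).2)).1 ∈ _ from hsb x)]
    exact (hs1 x).symm

variable (𝕜 F V) in
/-- The natural identification `F^λ(V)[λ] ≅ V`, `[f, u] ↦ f(u)`, as a homeomorphism. -/
def assocHomeo : AssocBundle 𝕜 F V ≃ₜ TotalSpace F V where
  toEquiv := Equiv.ofBijective assocToFun assocToFun_bijective
  continuous_toFun := continuous_frameEval.quotient_lift _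
  continuous_invFun := by
    rw [continuous_iff_continuousAt]
    intro v
    let e := trivializationAt F V v.1
    have he : v ∈ e.source := by
      rw [e.mem_source]; exact mem_baseSet_trivializationAt F V v.1
    exact (continuousOn_inv e).continuousAt (e.open_source.mem_nhds he)

/-- The charts of the associated bundle: for every local trivialization `e` of `V`, with local
frame `σ_e`, the map `(m, u) ↦ [σ_e(m), u]` is the inverse of a local trivialization. Equivalently,
the charts are those of `V`, composed with `[f, u] ↦ f(u)`. -/
instance assocChartedSpace : ChartedSpace (ModelProd H F) (AssocBundle 𝕜 F V) where
  atlas := {c | ∃ c' ∈ atlas (ModelProd H F) (TotalSpace F V),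
    c = (assocHomeo 𝕜 F V).transOpenPartialHomeomorph c'}
  chartAt a := (assocHomeo 𝕜 F V).transOpenPartialHomeomorph
    (chartAt (ModelProd H F) (assocHomeo 𝕜 F V a))
  mem_chart_source a := mem_chart_source (ModelProd H F) (assocHomeo 𝕜 F V a)
  chart_mem_atlas _ := ⟨_, chart_mem_atlas _ _, rfl⟩

instance assocIsManifold [IsManifold I ∞ M] [ContMDiffVectorBundle ∞ F V I] :
    IsManifold (I.prod 𝓘(ℝ, F)) ∞ (AssocBundle 𝕜 F V) where
  compatible := by
    rintro _ _ ⟨c, hc, rfl⟩ ⟨c', hc', rfl⟩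
    have h := HasGroupoid.compatible (G := contDiffGroupoid ∞ (I.prod 𝓘(ℝ, F))) hc hc'
    refine (contDiffGroupoid ∞ (I.prod 𝓘(ℝ, F))).mem_of_eqOnSource h ⟨?_, ?_⟩
    · ext x
      simp
    · intro x _
      simp

variable (𝕜 F V) in
/-- The bundle projection `F^λ(V)[λ] → M`, `[f, u] ↦ π(f)`. -/
def assocProj : AssocBundle 𝕜 F V → M :=
  Quotient.lift (fun a => frameProj a.1) (by rintro a _ ⟨g, rfl⟩; rfl)

end Generic

section Connections

/-- A connection on a bundle `pr : P → M`, given by its vertical projection: a smooth morphism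
`P_V : TP → TP` of vector bundles over `P` which is a fibrewise linear projection onto the vertical
bundle `VP = ker (T pr)`. (The horizontal bundle is `ker P_V`.) -/
@[ext]
structure Connection {EP : Type*} [NormedAddCommGroup EP] [NormedSpace ℝ EP] {HP : Type*}
    [TopologicalSpace HP] (J : ModelWithCorners ℝ EP HP) {E : Type*} [NormedAddCommGroup E]
    [NormedSpace ℝ E] {H : Type*} [TopologicalSpace H] (I : ModelWithCorners ℝ E H)
    {P : Type*} [TopologicalSpace P] [ChartedSpace HP P] [IsManifold J ∞ P]
    {M : Type*} [TopologicalSpace M] [ChartedSpace H M] (pr : P → M) where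
  /-- The vertical projection at a point. -/
  vert : ∀ p : P, TangentSpace J p →L[ℝ] TangentSpace J p
  idempotent : ∀ p ξ, vert p (vert p ξ) = vert p ξ
  range_vert : ∀ p, Set.range (vert p) = {ξ : TangentSpace J p | mfderiv J I pr p ξ = 0}
  smooth : ContMDiff J.tangent J.tangent ∞
    (fun ξ : TangentBundle J P => (⟨ξ.1, vert ξ.1 ξ.2⟩ : TangentBundle J P))

variable (𝕜 : Type*) [RCLike 𝕜] {E : Type*} [NormedAddCommGroup E] [NormedSpace ℝ E]
  {H : Type*} [TopologicalSpace H] (I : ModelWithCorners ℝ E H)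
  {M : Type*} [TopologicalSpace M] [ChartedSpace H M]
  (F : Type*) [NormedAddCommGroup F] [NormedSpace 𝕜 F] [NormedSpace ℝ F] [IsScalarTower ℝ 𝕜 F]
  [FiniteDimensional ℝ F]
  (V : M → Type*) [∀ x, AddCommGroup (V x)] [∀ x, Module 𝕜 (V x)] [∀ x, Module ℝ (V x)]
  [∀ x, IsScalarTower ℝ 𝕜 (V x)] [∀ x, TopologicalSpace (V x)]
  [∀ x, IsTopologicalAddGroup (V x)] [∀ x, ContinuousSMul 𝕜 (V x)] [∀ x, ContinuousSMul ℝ (V x)]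
  [TopologicalSpace (TotalSpace F V)] [FiberBundle F V] [VectorBundle 𝕜 F V] [VectorBundle ℝ F V]

/-- Fibrewise scalar multiplication `V → V`, `v ↦ c v`. -/
def fibreSMul (c : 𝕜) (v : TotalSpace F V) : TotalSpace F V := ⟨v.1, c • v.2⟩

/-- Fibrewise addition `V ×_M V → V`, `(v, w) ↦ v + w`. -/
def fibreAdd (w : TotalSpace (F × F) (V ×ᵇ V)) : TotalSpace F V := ⟨w.1, w.2.1 + w.2.2⟩

/-- First projection `V ×_M V → V`. -/
def fibreFst (w : TotalSpace (F × F) (V ×ᵇ V)) : TotalSpace F V := ⟨w.1, w.2.1⟩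

/-- Second projection `V ×_M V → V`. -/
def fibreSnd (w : TotalSpace (F × F) (V ×ᵇ V)) : TotalSpace F V := ⟨w.1, w.2.2⟩

variable [IsManifold I ∞ M] [ContMDiffVectorBundle ∞ F V I]

/-- An affine connection on the vector bundle `V → M`: a connection whose vertical projection is
also linear on the fibres of `Tπ : TV → TM`. The scalar multiplication of the vector bundle
`Tπ : TV → TM` is `T(fibreSMul c)`, and its addition is
`T(fibreAdd) : T(V ×_M V) = TV ×_{TM} TV → TV`: the vector `ζ` below stands for the pair
`(T fibreFst ζ, T fibreSnd ζ)` of vectors with the same image in `TM`, and `ζ'` for the pair of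
their images under the vertical projection. -/
@[ext]
structure AffineConnection extends
    Connection (I.prod 𝓘(ℝ, F)) I (TotalSpace.proj : TotalSpace F V → M) where
  map_smul : ∀ (c : 𝕜) (v : TotalSpace F V) (ξ : TangentSpace (I.prod 𝓘(ℝ, F)) v),
    vert (fibreSMul 𝕜 F V c v)
        (mfderiv (I.prod 𝓘(ℝ, F)) (I.prod 𝓘(ℝ, F)) (fibreSMul 𝕜 F V c) v ξ) =
      mfderiv (I.prod 𝓘(ℝ, F)) (I.prod 𝓘(ℝ, F)) (fibreSMul 𝕜 F V c) v (vert v ξ)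
  map_add : ∀ (w : TotalSpace (F × F) (V ×ᵇ V))
    (ζ ζ' : TangentSpace (I.prod 𝓘(ℝ, F × F)) w),
    mfderiv (I.prod 𝓘(ℝ, F × F)) (I.prod 𝓘(ℝ, F)) (fibreFst F V) w ζ' =
      vert (fibreFst F V w)
        (mfderiv (I.prod 𝓘(ℝ, F × F)) (I.prod 𝓘(ℝ, F)) (fibreFst F V) w ζ) →
    mfderiv (I.prod 𝓘(ℝ, F × F)) (I.prod 𝓘(ℝ, F)) (fibreSnd F V) w ζ' =
      vert (fibreSnd F V w)
        (mfderiv (I.prod 𝓘(ℝ, F × F)) (I.prod 𝓘(ℝ, F)) (fibreSnd F V) w ζ) →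
    vert (fibreAdd F V w)
        (mfderiv (I.prod 𝓘(ℝ, F × F)) (I.prod 𝓘(ℝ, F)) (fibreAdd F V) w ζ) =
      mfderiv (I.prod 𝓘(ℝ, F × F)) (I.prod 𝓘(ℝ, F)) (fibreAdd F V) w ζ'

/-- A principal connection on the frame bundle: a connection whose vertical projection commutes
with the tangent maps of the right translations by the elements of `GL(F)`. -/
@[ext]
structure PrincipalConnection extends
    Connection (I.prod 𝓘(ℝ, F →L[𝕜] F)) I (frameProj : FrameBundle 𝕜 F V → M) where
  equivariant : ∀ (g : F ≃L[𝕜] F) (p : FrameBundle 𝕜 F V)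
    (ξ : TangentSpace (I.prod 𝓘(ℝ, F →L[𝕜] F)) p),
    vert (frameAct g p)
        (mfderiv (I.prod 𝓘(ℝ, F →L[𝕜] F)) (I.prod 𝓘(ℝ, F →L[𝕜] F)) (frameAct g) p ξ) =
      mfderiv (I.prod 𝓘(ℝ, F →L[𝕜] F)) (I.prod 𝓘(ℝ, F →L[𝕜] F)) (frameAct g) p (vert p ξ)

variable {𝕜 I F V}

/-- `B` is the connection induced by the principal connection `P` on the associated bundle:
`B ∘ Tq = Tq ∘ (P × id)`, with `q : F^λ(V) × F → F^λ(V)[λ]` the quotient map. -/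
def IsInduced (P : PrincipalConnection 𝕜 I F V)
    (B : Connection (I.prod 𝓘(ℝ, F)) I (assocProj 𝕜 F V)) : Prop :=
  ∀ (a : FrameBundle 𝕜 F V × F) (ξ : TangentSpace (I.prod 𝓘(ℝ, F →L[𝕜] F)) a.1)
    (η : TangentSpace 𝓘(ℝ, F) a.2),
    B.vert (assocMk a)
        (mfderiv ((I.prod 𝓘(ℝ, F →L[𝕜] F)).prod 𝓘(ℝ, F)) (I.prod 𝓘(ℝ, F)) assocMk a (ξ, η)) =
      mfderiv ((I.prod 𝓘(ℝ, F →L[𝕜] F)).prod 𝓘(ℝ, F)) (I.prod 𝓘(ℝ, F)) assocMk a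
        (P.vert a.1 ξ, η)

/-- The affine connection `A` on `V` and the connection `B` on the associated bundle correspond to
each other under the natural identification `θ : F^λ(V)[λ] ≅ V`: `A ∘ Tθ = Tθ ∘ B`. -/
def IsIdentified (B : Connection (I.prod 𝓘(ℝ, F)) I (assocProj 𝕜 F V))
    (A : AffineConnection 𝕜 I F V) : Prop :=
  ∀ (b : AssocBundle 𝕜 F V) (ξ : TangentSpace (I.prod 𝓘(ℝ, F)) b),
    A.vert (assocHomeo 𝕜 F V b)
        (mfderiv (I.prod 𝓘(ℝ, F)) (I.prod 𝓘(ℝ, F)) (assocHomeo 𝕜 F V) b ξ) =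
      mfderiv (I.prod 𝓘(ℝ, F)) (I.prod 𝓘(ℝ, F)) (assocHomeo 𝕜 F V) b (B.vert b ξ)

end Connections

end FrameConn

end

open FrameConn

/-! Write `ev : F^λ(V) × F → V` for the evaluation `(f, u) ↦ f u` (`frameEval`). It equals `θ ∘ q`,
it has smooth local sections, and its fibres are the `GL(F)`-orbits. As `q` and `Tq` are surjective,
the condition `A ∘ Tθ = Tθ ∘ P[λ]` is equivalent to `A ∘ T ev = T ev ∘ (P × id)`, which is
`Intertwines P A` (see `IsInduced.isIdentified_iff`). It remains to show that this relation between
affine and principal connections is the graph of a bijection.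

From `P` to `A` (`existsUnique_affine`): `A` is unique because `T ev` is surjective. It exists
because `P × id` descends. Two vectors with the same image under `T ev` can be moved to one base
point by the group, and `P × id` commutes with this by equivariance. Their difference then lies in
`ker T ev`, so its frame component is vertical and `P × id` fixes it (`vertProd_compat`). Smoothness
comes from local sections (`exists_descent`). The descended connection is linear on the fibres of
`Tπ` because scalar multiplication and addition in `V` lift to maps `id × L` with `L` linear, and
these commute with `P × id`.

From `A` to `P` (`existsUnique_principal`): with `ev_u f = f u`, the relation says `T ev_u (P ξ) = A
(T ev_u ξ)` for all `u` (`intertwines_iff`). A tangent vector of the frame bundle is determined by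
its images under all `T ev_u` (`frame_tangent_ext_evalAt`), so `P` is unique. For existence, the
fibre coordinate of `A (T ev_u ξ)` is `𝕜`-linear in `u`, precisely because `A` is linear on the
fibres of `Tπ`. It is therefore an endomorphism of `F`, hence the coordinate of a vertical vector of
the frame bundle (`exists_vert`). Equivariance follows from `ev_u ∘ ρ_g = ev_{g u}`. -/

namespace FrameConn

/-! ### Tangent maps and descent along maps with local sections -/

section General

variable {E₁ E₂ E₃ : Type*} [NormedAddCommGroup E₁] [NormedSpace ℝ E₁]
  [NormedAddCommGroup E₂] [NormedSpace ℝ E₂] [NormedAddCommGroup E₃] [NormedSpace ℝ E₃]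
  {H₁ H₂ H₃ : Type*} [TopologicalSpace H₁] [TopologicalSpace H₂] [TopologicalSpace H₃]
  {I₁ : ModelWithCorners ℝ E₁ H₁} {I₂ : ModelWithCorners ℝ E₂ H₂} {I₃ : ModelWithCorners ℝ E₃ H₃}
  {X : Type*} [TopologicalSpace X] [ChartedSpace H₁ X]
  {Y : Type*} [TopologicalSpace Y] [ChartedSpace H₂ Y]
  {Z : Type*} [TopologicalSpace Z] [ChartedSpace H₃ Z]

/-- Every tangent space is definitionally the model space, so vectors at propositionally equal
points can be compared there without transport. -/
theorem tangentBundle_mk_eq {x y : X} (h : x = y) {ξ : TangentSpace I₁ x} {η : TangentSpace I₁ y}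
    (h' : (ξ : E₁) = (η : E₁)) : (⟨x, ξ⟩ : TangentBundle I₁ X) = ⟨y, η⟩ := by
  subst h
  exact congrArg (TotalSpace.mk x) h'

theorem tangentBundle_snd_eq {ξ η : TangentBundle I₁ X} (h : ξ = η) :
    (ξ.2 : E₁) = (η.2 : E₁) := by
  subst h; rfl

/-- On an open set the derivative within the set is the full derivative, so smoothness passes from
`tangentMapWithin` to `tangentMap`. -/
theorem contMDiffAt_tangentMap [IsManifold I₁ ∞ X] [IsManifold I₂ ∞ Y] {f : X → Y} {s : Set X}
    (hf : ContMDiffOn I₁ I₂ ∞ f s) (hs : IsOpen s) {ξ : TangentBundle I₁ X} (hξ : ξ.1 ∈ s) :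
    ContMDiffAt I₁.tangent I₂.tangent ∞ (tangentMap I₁ I₂ f) ξ := by
  have h := hf.contMDiffOn_tangentMapWithin (m := ∞) le_rfl hs.uniqueMDiffOn
  have ho : IsOpen (π E₁ (TangentSpace I₁ : X → Type _) ⁻¹' s) :=
    hs.preimage (FiberBundle.continuous_proj E₁ (TangentSpace I₁ : X → Type _))
  refine (h.contMDiffAt (ho.mem_nhds hξ)).congr_of_eventuallyEq ?_
  filter_upwards [ho.mem_nhds hξ] with η hη
  exact (tangentMapWithin_eq_tangentMap (hs.uniqueMDiffWithinAt hη)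
    (((hf _ hη).contMDiffAt (hs.mem_nhds hη)).mdifferentiableAt (by simp))).symm

theorem contMDiff_snd_tangentBundle_vectorSpace :
    ContMDiff (𝓘(ℝ, E₁)).tangent 𝓘(ℝ, E₁) ∞ (fun ξ : TangentBundle 𝓘(ℝ, E₁) E₁ => (ξ.2 : E₁)) :=
  contMDiff_snd_tangentBundle_modelSpace E₁ 𝓘(ℝ, E₁)

/-- The chain rule for a composition which is only known near the point. -/
theorem mfderiv_mfderiv_eq {f : X → Y} {g : Y → Z} {h : X → Z} {x : X} {y : Y} (hy : f x = y)
    (hg : MDifferentiableAt I₂ I₃ g y) (hf : MDifferentiableAt I₁ I₂ f x)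
    (hh : ∀ᶠ x' in 𝓝 x, g (f x') = h x') (ξ : TangentSpace I₁ x) :
    (mfderiv I₂ I₃ g y (mfderiv I₁ I₂ f x ξ : E₂) : E₃) = (mfderiv I₁ I₃ h x ξ : E₃) := by
  subst hy
  have h1 : (g ∘ f) =ᶠ[𝓝 x] h := hh
  have h2 := mfderiv_comp x hg hf
  rw [h1.mfderiv_eq] at h2
  exact (congrArg (fun L : E₁ →L[ℝ] E₃ => L ξ) h2).symm

theorem mfderiv_id_of_eventually {h : X → X} {x : X} (hh : ∀ᶠ x' in 𝓝 x, h x' = x')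
    (ξ : TangentSpace I₁ x) : (mfderiv I₁ I₁ h x ξ : E₁) = (ξ : E₁) := by
  have h1 : h =ᶠ[𝓝 x] id := hh
  have h2 : mfderiv I₁ I₁ h x = mfderiv I₁ I₁ id x := h1.mfderiv_eq
  rw [mfderiv_id] at h2
  exact congrArg (fun L : E₁ →L[ℝ] E₁ => L ξ) h2

/-- A map with local sections through all points of its source and onto its target. -/
structure HasLocalSections (I₁ : ModelWithCorners ℝ E₁ H₁) (I₂ : ModelWithCorners ℝ E₂ H₂)
    (q : X → Y) : Prop where
  smooth : ContMDiff I₁ I₂ ∞ q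
  surjective : Function.Surjective q
  exists_section : ∀ x, ∃ (S : Y → X) (s : Set Y), IsOpen s ∧ q x ∈ s ∧ S (q x) = x ∧
    ContMDiffOn I₂ I₁ ∞ S s ∧ ∀ y ∈ s, q (S y) = y

/-- The derivative of a local section through `x` is a right inverse of the derivative of `q` at
`x`. -/
theorem HasLocalSections.surjective_mfderiv {q : X → Y} (hq : HasLocalSections I₁ I₂ q) (x : X) :
    Function.Surjective (mfderiv I₁ I₂ q x) := by
  intro η
  obtain ⟨S, s, hs, hx, hSx, hS, hqS⟩ := hq.exists_section x
  refine ⟨(mfderiv I₂ I₁ S (q x) η : E₁), ?_⟩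
  have hn := hs.mem_nhds hx
  have h := mfderiv_mfderiv_eq (h := fun y => y) hSx
    (hq.smooth.mdifferentiableAt (by simp)) ((hS.contMDiffAt hn).mdifferentiableAt (by simp))
    (Filter.eventually_of_mem hn hqS) η
  exact h.trans (mfderiv_id_of_eventually (by simp) η)

/-- Descent of a smooth field of endomorphisms of the tangent spaces along a submersion. -/
theorem exists_descent [IsManifold I₁ ∞ X] [IsManifold I₂ ∞ Y] {q : X → Y}
    (hq : HasLocalSections I₁ I₂ q)
    (D : ∀ x : X, TangentSpace I₁ x →L[ℝ] TangentSpace I₁ x)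
    (hD : ContMDiff I₁.tangent I₁.tangent ∞
      (fun ξ : TangentBundle I₁ X => (⟨ξ.1, D ξ.1 ξ.2⟩ : TangentBundle I₁ X)))
    (hc : ∀ ξ η : TangentBundle I₁ X, tangentMap I₁ I₂ q ξ = tangentMap I₁ I₂ q η →
      tangentMap I₁ I₂ q ⟨ξ.1, D ξ.1 ξ.2⟩ = tangentMap I₁ I₂ q ⟨η.1, D η.1 η.2⟩) :
    ∃ C : ∀ y : Y, TangentSpace I₂ y →L[ℝ] TangentSpace I₂ y,
      ContMDiff I₂.tangent I₂.tangent ∞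
        (fun ξ : TangentBundle I₂ Y => (⟨ξ.1, C ξ.1 ξ.2⟩ : TangentBundle I₂ Y)) ∧
      ∀ x (ξ : TangentSpace I₁ x),
        C (q x) (mfderiv I₁ I₂ q x ξ) = mfderiv I₁ I₂ q x (D x ξ) := by
  have key : ∀ y, ∃ (S : Y → X) (s : Set Y), IsOpen s ∧ y ∈ s ∧
      ContMDiffOn I₂ I₁ ∞ S s ∧ ∀ y ∈ s, q (S y) = y := fun y => by
    obtain ⟨x, rfl⟩ := hq.surjective y
    obtain ⟨S, s, hs, hx, -, hS, hqS⟩ := hq.exists_section x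
    exact ⟨S, s, hs, hx, hS, hqS⟩
  choose S s hs hys hS hqS using key
  -- `C = Tq ∘ D ∘ TS` at `y`, with the section chosen for that very `y`. The sections vary wildly
  -- with `y`; smoothness is recovered because `hc` makes the value independent of the section, so
  -- one fixed section serves in a whole neighbourhood (`hC'`).
  let C : ∀ y : Y, TangentSpace I₂ y →L[ℝ] TangentSpace I₂ y := fun y =>
    ((show E₁ →L[ℝ] E₂ from mfderiv I₁ I₂ q (S y y)).comp
      (show E₁ →L[ℝ] E₁ from D (S y y))).comp (show E₂ →L[ℝ] E₁ from mfderiv I₂ I₁ (S y) y)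
  have hT : ∀ y (ξ : TangentBundle I₂ Y), ξ.1 ∈ s y →
      tangentMap I₁ I₂ q (tangentMap I₂ I₁ (S y) ξ) = ξ := fun y ξ hξ => by
    have hn := (hs y).mem_nhds hξ
    refine tangentBundle_mk_eq (hqS y _ hξ) ?_
    refine (mfderiv_mfderiv_eq (h := fun y => y) rfl
      (hq.smooth.mdifferentiableAt (by simp))
      (((hS y).contMDiffAt hn).mdifferentiableAt (by simp))
      (Filter.eventually_of_mem hn (hqS y)) ξ.2).trans (mfderiv_id_of_eventually (by simp) ξ.2)
  have hC : ∀ ξ : TangentBundle I₂ Y, (⟨ξ.1, C ξ.1 ξ.2⟩ : TangentBundle I₂ Y) =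
      tangentMap I₁ I₂ q ⟨_, D _ (tangentMap I₂ I₁ (S ξ.1) ξ).2⟩ := fun ξ =>
    tangentBundle_mk_eq (hqS _ _ (hys _)).symm rfl
  have hC' : ∀ y (ξ : TangentBundle I₂ Y), ξ.1 ∈ s y → (⟨ξ.1, C ξ.1 ξ.2⟩ : TangentBundle I₂ Y) =
      tangentMap I₁ I₂ q ⟨_, D _ (tangentMap I₂ I₁ (S y) ξ).2⟩ := fun y ξ hξ =>
    (hC ξ).trans (hc _ _ ((hT _ _ (hys _)).trans (hT _ _ hξ).symm))
  refine ⟨C, fun ξ => ?_, fun x ξ => ?_⟩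
  · have h1 := contMDiffAt_tangentMap (hS ξ.1) (hs _) (ξ := ξ) (hys _)
    have h2 := (hq.smooth.contMDiff_tangentMap (m := ∞) le_rfl).contMDiffAt.comp ξ
      (hD.contMDiffAt.comp ξ h1)
    refine h2.congr_of_eventuallyEq ?_
    have ho : IsOpen (π E₂ (TangentSpace I₂ : Y → Type _) ⁻¹' s ξ.1) :=
      (hs _).preimage (FiberBundle.continuous_proj E₂ (TangentSpace I₂ : Y → Type _))
    filter_upwards [ho.mem_nhds (hys ξ.1)] with η hη
    exact hC' ξ.1 η hη
  · have h1 := (hC (tangentMap I₁ I₂ q ⟨x, ξ⟩)).trans (hc _ ⟨x, ξ⟩ (hT _ _ (hys _)))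
    exact tangentBundle_snd_eq h1

end General

/-! ### Smoothness and local coordinates on the frame bundle -/

section BundleMaps
variable {𝕜 : Type*} [RCLike 𝕜] {E : Type*} [NormedAddCommGroup E] [NormedSpace ℝ E]
  {H : Type*} [TopologicalSpace H] {I : ModelWithCorners ℝ E H}
  {M : Type*} [TopologicalSpace M] [ChartedSpace H M]
  {F : Type*} [NormedAddCommGroup F] [NormedSpace 𝕜 F] [NormedSpace ℝ F] [IsScalarTower ℝ 𝕜 F]
  [FiniteDimensional ℝ F]
  {V : M → Type*} [∀ x, AddCommGroup (V x)] [∀ x, Module 𝕜 (V x)] [∀ x, Module ℝ (V x)]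
  [∀ x, IsScalarTower ℝ 𝕜 (V x)] [∀ x, TopologicalSpace (V x)]
  [∀ x, IsTopologicalAddGroup (V x)] [∀ x, ContinuousSMul 𝕜 (V x)] [∀ x, ContinuousSMul ℝ (V x)]
  [TopologicalSpace (TotalSpace F V)] [FiberBundle F V] [VectorBundle 𝕜 F V] [VectorBundle ℝ F V]
  [IsManifold I ∞ M] [ContMDiffVectorBundle ∞ F V I]
  {E' : Type*} [NormedAddCommGroup E'] [NormedSpace ℝ E'] {H' : Type*} [TopologicalSpace H']
  {I' : ModelWithCorners ℝ E' H'} {X : Type*} [TopologicalSpace X] [ChartedSpace H' X]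

instance homTriv_mem (e : Trivialization F (π F V)) [h : MemTrivializationAtlas e] :
    MemTrivializationAtlas (homTriv 𝕜 e) :=
  ⟨⟨_, ⟨Bundle.Trivial.trivialization M F, e, inferInstance, h, rfl⟩, rfl⟩⟩

variable (𝕜 F) in
theorem contDiff_clm_apply : ContDiff ℝ ∞ (fun a : (F →L[𝕜] F) × F => a.1 a.2) := by
  have := homFinite 𝕜 F
  let B : (F →L[𝕜] F) →ₗ[ℝ] F →L[ℝ] F :=
    { toFun := fun A => A.restrictScalars ℝ
      map_add' := fun _ _ => rfl
      map_smul' := fun _ _ => rfl }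
  exact (LinearMap.toContinuousLinearMap B).contDiff.fst'.clm_apply contDiff_snd

theorem contMDiffAt_clm_apply {A : X → F →L[𝕜] F} {u : X → F} {x : X}
    (hA : ContMDiffAt I' 𝓘(ℝ, F →L[𝕜] F) ∞ A x) (hu : ContMDiffAt I' 𝓘(ℝ, F) ∞ u x) :
    ContMDiffAt I' 𝓘(ℝ, F) ∞ (fun y => A y (u y)) x :=
  (contDiff_clm_apply 𝕜 F).contMDiff.contMDiffAt.comp x (hA.prodMk_space hu)

/-- An operator is determined by its values on a finite real basis, and a linear left inverse of
this embedding into a power of `F` recovers it smoothly. -/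
theorem contMDiffAt_clm_of_apply {A : X → F →L[𝕜] F} {x : X}
    (hA : ∀ u, ContMDiffAt I' 𝓘(ℝ, F) ∞ (fun y => A y u) x) :
    ContMDiffAt I' 𝓘(ℝ, F →L[𝕜] F) ∞ A x := by
  have := homFinite 𝕜 F
  let b := Module.finBasis ℝ F
  let T : (F →L[𝕜] F) →ₗ[ℝ] (Fin (Module.finrank ℝ F) → F) :=
    { toFun := fun A i => A (b i)
      map_add' := fun _ _ => rfl
      map_smul' := fun _ _ => rfl }
  have hT : LinearMap.ker T = ⊥ := by
    refine LinearMap.ker_eq_bot'.2 fun A hA => ?_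
    have : A.restrictScalars ℝ = (0 : F →L[ℝ] F) :=
      ContinuousLinearMap.coe_injective (b.ext fun i => congrFun hA i)
    ext v
    exact congrArg (fun B : F →L[ℝ] F => B v) this
  obtain ⟨L, hL⟩ := LinearMap.exists_leftInverse_of_injective T hT
  have h : ContMDiffAt I' 𝓘(ℝ, Fin (Module.finrank ℝ F) → F) ∞ (fun y => T (A y)) x :=
    contMDiffAt_pi_space.2 fun i => hA (b i)
  have hL' : ContDiff ℝ ∞ (LinearMap.toContinuousLinearMap L) := ContinuousLinearMap.contDiff _
  refine (hL'.contMDiff.contMDiffAt.comp x h).congr_of_eventuallyEq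
    (Filter.Eventually.of_forall fun y => ?_)
  exact (LinearMap.congr_fun hL (A y)).symm

theorem contMDiff_frameVal : ContMDiff (I.prod 𝓘(ℝ, F →L[𝕜] F)) (I.prod 𝓘(ℝ, F →L[𝕜] F)) ∞
    (Subtype.val : FrameBundle 𝕜 F V → _) :=
  contMDiff_subtype_val

theorem contMDiff_frameProj : ContMDiff (I.prod 𝓘(ℝ, F →L[𝕜] F)) I ∞
    (frameProj : FrameBundle 𝕜 F V → M) :=
  (contMDiff_proj _).comp contMDiff_frameVal

/-- The frame `p` in terms of a local trivialization `e` of `V`. -/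
noncomputable def frameCoord (e : Trivialization F (π F V)) [MemTrivializationAtlas e]
    (p : FrameBundle 𝕜 F V) : F →L[𝕜] F := (homTriv 𝕜 e p.1).2

theorem frameCoord_apply (e : Trivialization F (π F V)) [MemTrivializationAtlas e]
    {p : FrameBundle 𝕜 F V} (hp : frameProj p ∈ e.baseSet) (u : F) :
    frameCoord e p u = (e (frameEval (p, u))).2 :=
  homTriv_apply e p.1 hp u

theorem frameCoord_bijective (e : Trivialization F (π F V)) [MemTrivializationAtlas e]
    {p : FrameBundle 𝕜 F V} (hp : frameProj p ∈ e.baseSet) :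
    Function.Bijective (frameCoord e p) :=
  (homTriv_eq_comp e p.1 hp).2 p.2

theorem mem_homTriv_source (e : Trivialization F (π F V)) [MemTrivializationAtlas e]
    {p : TotalSpace (F →L[𝕜] F) (fun x => Bundle.Trivial M F x →L[𝕜] V x)}
    (hp : p.1 ∈ e.baseSet) : p ∈ (homTriv 𝕜 e).source := by
  rwa [(homTriv 𝕜 e).mem_source, homTriv_baseSet]

theorem contMDiffAt_frame_iff {f : X → FrameBundle 𝕜 F V} {x : X}
    (e : Trivialization F (π F V)) [MemTrivializationAtlas e] (hx : frameProj (f x) ∈ e.baseSet) :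
    ContMDiffAt I' (I.prod 𝓘(ℝ, F →L[𝕜] F)) ∞ f x ↔
      ContMDiffAt I' I ∞ (fun y => frameProj (f y)) x ∧
        ContMDiffAt I' 𝓘(ℝ, F →L[𝕜] F) ∞ (fun y => frameCoord e (f y)) x := by
  rw [← ContMDiffAt.subtypeVal_comp_iff]
  exact Trivialization.contMDiffAt_iff (e := homTriv 𝕜 e) (mem_homTriv_source e hx)

theorem contMDiffAt_frameCoord (e : Trivialization F (π F V)) [MemTrivializationAtlas e]
    {p : FrameBundle 𝕜 F V} (hp : frameProj p ∈ e.baseSet) :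
    ContMDiffAt (I.prod 𝓘(ℝ, F →L[𝕜] F)) 𝓘(ℝ, F →L[𝕜] F) ∞ (frameCoord e) p :=
  ((contMDiffAt_frame_iff (f := id) e hp).1 contMDiffAt_id).2

theorem contMDiffAt_total_iff {f : X → TotalSpace F V} {x : X}
    (e : Trivialization F (π F V)) [MemTrivializationAtlas e] (hx : (f x).1 ∈ e.baseSet) :
    ContMDiffAt I' (I.prod 𝓘(ℝ, F)) ∞ f x ↔
      ContMDiffAt I' I ∞ (fun y => (f y).1) x ∧
        ContMDiffAt I' 𝓘(ℝ, F) ∞ (fun y => (e (f y)).2) x :=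
  Trivialization.contMDiffAt_iff (e := e) (e.mem_source.2 hx)

theorem contMDiffAt_coord (e : Trivialization F (π F V)) [MemTrivializationAtlas e]
    {v : TotalSpace F V} (hv : v.1 ∈ e.baseSet) :
    ContMDiffAt (I.prod 𝓘(ℝ, F)) 𝓘(ℝ, F) ∞ (fun v : TotalSpace F V => (e v).2) v :=
  ((contMDiffAt_total_iff (f := id) e hv).1 contMDiffAt_id).2

theorem contMDiff_frameEval : ContMDiff ((I.prod 𝓘(ℝ, F →L[𝕜] F)).prod 𝓘(ℝ, F)) (I.prod 𝓘(ℝ, F)) ∞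
    (frameEval (𝕜 := 𝕜) (F := F) (V := V)) := by
  intro a
  let e := trivializationAt F V (frameProj a.1)
  have he : frameProj a.1 ∈ e.baseSet := mem_baseSet_trivializationAt F V _
  have hp : ContMDiff ((I.prod 𝓘(ℝ, F →L[𝕜] F)).prod 𝓘(ℝ, F)) I ∞
    (fun a : FrameBundle 𝕜 F V × F => frameProj a.1) := contMDiff_frameProj.comp contMDiff_fst
  refine (contMDiffAt_total_iff e he).2 ⟨hp.contMDiffAt, ?_⟩
  have h := contMDiffAt_clm_apply ((contMDiffAt_frameCoord (𝕜 := 𝕜) (I := I) e he).comp a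
    contMDiffAt_fst) (contMDiffAt_snd (I := I.prod 𝓘(ℝ, F →L[𝕜] F)) (J := 𝓘(ℝ, F)))
  refine h.congr_of_eventuallyEq ?_
  filter_upwards [hp.continuous.continuousAt (e.open_baseSet.mem_nhds he)] with b hb
  exact (frameCoord_apply e hb b.2).symm

theorem contMDiff_frameAct (g : F ≃L[𝕜] F) :
    ContMDiff (I.prod 𝓘(ℝ, F →L[𝕜] F)) (I.prod 𝓘(ℝ, F →L[𝕜] F)) ∞
      (frameAct (V := V) g) := by
  intro p
  let e := trivializationAt F V (frameProj p)
  have he : frameProj p ∈ e.baseSet := mem_baseSet_trivializationAt F V _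
  refine (contMDiffAt_frame_iff e he).2 ⟨contMDiff_frameProj.contMDiffAt, ?_⟩
  refine contMDiffAt_clm_of_apply fun u => ?_
  have h := contMDiffAt_clm_apply (contMDiffAt_frameCoord (𝕜 := 𝕜) (I := I) e he)
    (contMDiffAt_const (c := g u))
  refine h.congr_of_eventuallyEq ?_
  filter_upwards [(contMDiff_frameProj (I := I)).continuous.continuousAt
    (e.open_baseSet.mem_nhds he)] with b hb
  rw [frameCoord_apply e hb]
  exact frameCoord_apply (p := frameAct g b) e hb u

open Classical in
/-- The frame with coordinate `a.2` at the point `a.1` in the trivialization `e`; the value is `p₀`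
where this is not a frame. -/
noncomputable def frameOf (p₀ : FrameBundle 𝕜 F V) (e : Trivialization F (π F V))
    [MemTrivializationAtlas e]
    (a : M × (F →L[𝕜] F)) : FrameBundle 𝕜 F V :=
  if h : (homTriv 𝕜 e).toOpenPartialHomeomorph.symm a ∈ frameBundle 𝕜 F V then ⟨_, h⟩ else p₀

section frameOf
variable (p₀ : FrameBundle 𝕜 F V) (e : Trivialization F (π F V)) [MemTrivializationAtlas e]

theorem frameOf_val {a : M × (F →L[𝕜] F)} (ha : a.1 ∈ e.baseSet) (ha' : Function.Bijective a.2) :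
    (frameOf p₀ e a).1 = (homTriv 𝕜 e).toOpenPartialHomeomorph.symm a := by
  have hb : a.1 ∈ (homTriv 𝕜 e).baseSet := by rwa [homTriv_baseSet]
  have h : (homTriv 𝕜 e).toOpenPartialHomeomorph.symm a ∈ frameBundle 𝕜 F V := by
    refine (homTriv_eq_comp e _ ?_).1 ?_
    · rw [(homTriv 𝕜 e).proj_symm_apply' hb]; exact ha
    · rw [(homTriv 𝕜 e).apply_symm_apply' hb]; exact ha'
  rw [frameOf, dif_pos h]

theorem frameProj_frameOf {a : M × (F →L[𝕜] F)} (ha : a.1 ∈ e.baseSet)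
    (ha' : Function.Bijective a.2) : frameProj (frameOf p₀ e a) = a.1 := by
  have hb : a.1 ∈ (homTriv 𝕜 e).baseSet := by rwa [homTriv_baseSet]
  rw [frameProj, frameOf_val p₀ e ha ha']
  exact (homTriv 𝕜 e).proj_symm_apply' hb

theorem frameCoord_frameOf {a : M × (F →L[𝕜] F)} (ha : a.1 ∈ e.baseSet)
    (ha' : Function.Bijective a.2) : frameCoord e (frameOf p₀ e a) = a.2 := by
  have hb : a.1 ∈ (homTriv 𝕜 e).baseSet := by rwa [homTriv_baseSet]
  rw [frameCoord, frameOf_val p₀ e ha ha', (homTriv 𝕜 e).apply_symm_apply' hb]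

theorem frameOf_frameCoord {p : FrameBundle 𝕜 F V} (hp : frameProj p ∈ e.baseSet) :
    frameOf p₀ e (frameProj p, frameCoord e p) = p := by
  apply Subtype.ext
  refine (frameOf_val (a := (frameProj p, frameCoord e p)) p₀ e hp
    (frameCoord_bijective e hp)).trans ?_
  exact (homTriv 𝕜 e).symm_apply_mk_proj (mem_homTriv_source e hp)

variable (𝕜) in
/-- The domain of the chart `frameOf`. -/
def frameDomain : Set (M × (F →L[𝕜] F)) := {a | a.1 ∈ e.baseSet ∧ Function.Bijective a.2}

/-- The bijective operators are the units of the Banach algebra `F →L[𝕜] F`, and units form an open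
set. -/
theorem isOpen_frameDomain : IsOpen (frameDomain 𝕜 e) := by
  have : CompleteSpace F := FiniteDimensional.complete ℝ F
  have h : {A : F →L[𝕜] F | Function.Bijective A} = {A | IsUnit A} := by
    ext A; exact ContinuousLinearMap.isUnit_iff_bijective.symm
  have h2 : IsOpen {A : F →L[𝕜] F | Function.Bijective A} := h ▸ Units.isOpen
  exact (e.open_baseSet.preimage continuous_fst).inter (h2.preimage continuous_snd)

theorem contMDiffOn_frameOf : ContMDiffOn (I.prod 𝓘(ℝ, F →L[𝕜] F)) (I.prod 𝓘(ℝ, F →L[𝕜] F)) ∞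
    (frameOf p₀ e) (frameDomain 𝕜 e) := by
  intro a ha
  have hn := (isOpen_frameDomain (𝕜 := 𝕜) e).mem_nhds ha
  refine ContMDiffAt.contMDiffWithinAt ?_
  refine (contMDiffAt_frame_iff e ?_).2 ⟨?_, ?_⟩
  · rw [frameProj_frameOf p₀ e ha.1 ha.2]; exact ha.1
  · refine contMDiffAt_fst.congr_of_eventuallyEq ?_
    filter_upwards [hn] with b hb
    exact frameProj_frameOf p₀ e hb.1 hb.2
  · refine contMDiffAt_snd.congr_of_eventuallyEq ?_
    filter_upwards [hn] with b hb
    exact frameCoord_frameOf p₀ e hb.1 hb.2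

end frameOf

theorem total_ext (e : Trivialization F (π F V)) [MemTrivializationAtlas e] {v w : TotalSpace F V}
    (hv : v.1 ∈ e.baseSet) (h : v.1 = w.1) (h' : (e v).2 = (e w).2) : v = w := by
  refine e.injOn (e.mem_source.2 hv) (e.mem_source.2 (h ▸ hv)) (Prod.ext ?_ h')
  exact (e.coe_fst' hv).trans (h.trans (e.coe_fst' (h ▸ hv)).symm)

/-! ### The identification `θ` and local sections of the evaluation map -/

-- The charts of the associated bundle are those of `V` pulled back by `θ`, so near `b` the map `θ`
-- is a chart followed by the inverse of the corresponding chart of `V`.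
variable (𝕜 F V) in
theorem contMDiff_assocHomeo :
    ContMDiff (I.prod 𝓘(ℝ, F)) (I.prod 𝓘(ℝ, F)) ∞ (assocHomeo 𝕜 F V) := by
  intro b
  have h1 := (contMDiffOn_chart (I := I.prod 𝓘(ℝ, F)) (n := ∞) (x := b)).contMDiffAt
    ((chartAt (ModelProd H F) b).open_source.mem_nhds (mem_chart_source _ b))
  have h2 := (contMDiffOn_chart_symm (I := I.prod 𝓘(ℝ, F)) (n := ∞)
    (x := assocHomeo 𝕜 F V b)).contMDiffAt
    ((chartAt (ModelProd H F) (assocHomeo 𝕜 F V b)).open_target.mem_nhds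
      (mem_chart_target _ (assocHomeo 𝕜 F V b)))
  refine (ContMDiffAt.comp b (g := (chartAt (ModelProd H F) (assocHomeo 𝕜 F V b)).symm)
    h2 h1).congr_of_eventuallyEq ?_
  filter_upwards [(assocHomeo 𝕜 F V).continuous.continuousAt
    ((chartAt (ModelProd H F) (assocHomeo 𝕜 F V b)).open_source.mem_nhds
      (mem_chart_source _ _))] with c hc
  exact ((chartAt (ModelProd H F) (assocHomeo 𝕜 F V b)).left_inv hc).symm

variable (𝕜 F V) in
theorem contMDiff_assocHomeo_symm :
    ContMDiff (I.prod 𝓘(ℝ, F)) (I.prod 𝓘(ℝ, F)) ∞ (assocHomeo 𝕜 F V).symm := by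
  intro v
  obtain ⟨b, rfl⟩ := (assocHomeo 𝕜 F V).surjective v
  have h1 := (contMDiffOn_chart_symm (I := I.prod 𝓘(ℝ, F)) (n := ∞) (x := b)).contMDiffAt
    ((chartAt (ModelProd H F) b).open_target.mem_nhds (mem_chart_target _ b))
  have h2 := (contMDiffOn_chart (I := I.prod 𝓘(ℝ, F)) (n := ∞)
    (x := assocHomeo 𝕜 F V b)).contMDiffAt
    ((chartAt (ModelProd H F) (assocHomeo 𝕜 F V b)).open_source.mem_nhds
      (mem_chart_source _ (assocHomeo 𝕜 F V b)))
  refine (ContMDiffAt.comp (assocHomeo 𝕜 F V b) (g := (chartAt (ModelProd H F) b).symm)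
    h1 h2).congr_of_eventuallyEq ?_
  filter_upwards [(chartAt (ModelProd H F) (assocHomeo 𝕜 F V b)).open_source.mem_nhds
    (mem_chart_source _ _)] with c hc
  exact congrArg (assocHomeo 𝕜 F V).symm
    ((chartAt (ModelProd H F) (assocHomeo 𝕜 F V b)).left_inv hc).symm

/-- In a trivialization `e`, keep the coordinate `g` of the given frame constant over the base and
solve `g u' = (e v).2` for `u'`. The frame component then depends only on the base point of `v`;
this clause later allows two vectors of one fibre to be lifted with a common frame. -/
theorem exists_section_frameEval (a : FrameBundle 𝕜 F V × F) :
    ∃ (S : TotalSpace F V → FrameBundle 𝕜 F V × F) (U : Set M), IsOpen U ∧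
      frameProj a.1 ∈ U ∧ S (frameEval a) = a ∧
      (∀ v w, v.1 = w.1 → (S v).1 = (S w).1) ∧
      ContMDiffOn (I.prod 𝓘(ℝ, F)) ((I.prod 𝓘(ℝ, F →L[𝕜] F)).prod 𝓘(ℝ, F)) ∞ S {v | v.1 ∈ U} ∧
      ∀ v, v.1 ∈ U → frameEval (S v) = v := by
  have : FiniteDimensional 𝕜 F := Module.Finite.of_restrictScalars_finite ℝ 𝕜 F
  obtain ⟨p, u⟩ := a
  let e := trivializationAt F V (frameProj p)
  have he : frameProj p ∈ e.baseSet := mem_baseSet_trivializationAt F V _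
  have hb := frameCoord_bijective e he
  let g : F ≃L[𝕜] F :=
    (LinearEquiv.ofBijective (frameCoord e p : F →ₗ[𝕜] F) hb).toContinuousLinearEquiv
  have hg : ∀ v, frameCoord e p (g.symm v) = v := fun v => g.apply_symm_apply v
  have hg' : ∀ v, g.symm (frameCoord e p v) = v := fun v => g.symm_apply_apply v
  refine ⟨fun v => (frameOf p e (v.1, frameCoord e p), g.symm (e v).2), e.baseSet,
    e.open_baseSet, he, ?_, ?_, ?_, ?_⟩
  · refine Prod.ext (frameOf_frameCoord p e he) ?_
    change g.symm (e (frameEval (p, u))).2 = u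
    rw [← frameCoord_apply e he, hg']
  · intro v w h
    change frameOf p e (v.1, frameCoord e p) = frameOf p e (w.1, frameCoord e p)
    rw [h]
  · intro v hv
    refine ContMDiffAt.contMDiffWithinAt (ContMDiffAt.prodMk ?_ ?_)
    · have h1 := (contMDiffOn_frameOf (I := I) p e).contMDiffAt
        ((isOpen_frameDomain e).mem_nhds
          (show (v.1, frameCoord e p) ∈ frameDomain 𝕜 e from ⟨hv, hb⟩))
      exact ContMDiffAt.comp (I' := I.prod 𝓘(ℝ, F →L[𝕜] F)) v
        (f := fun v : TotalSpace F V => (v.1, frameCoord e p)) h1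
        ((contMDiff_proj V).contMDiffAt.prodMk contMDiffAt_const)
    · exact contMDiffAt_clm_apply (A := fun _ => (g.symm : F →L[𝕜] F)) contMDiffAt_const
        (contMDiffAt_coord e hv)
  · intro v hv
    have h1 : frameProj (frameOf p e (v.1, frameCoord e p)) = v.1 :=
      frameProj_frameOf p e (a := (v.1, frameCoord e p)) hv hb
    refine total_ext e ?_ h1 ?_
    · change frameProj (frameOf p e (v.1, frameCoord e p)) ∈ e.baseSet
      rw [h1]; exact hv
    · rw [← frameCoord_apply e (by rw [h1]; exact hv),
        frameCoord_frameOf p e (a := (v.1, frameCoord e p)) hv hb, hg]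

theorem isOpen_total_preimage {U : Set M} (hU : IsOpen U) :
    IsOpen {v : TotalSpace F V | v.1 ∈ U} :=
  hU.preimage (FiberBundle.continuous_proj F V)

variable (𝕜 F V I) in
theorem hasLocalSections_frameEval :
    HasLocalSections ((I.prod 𝓘(ℝ, F →L[𝕜] F)).prod 𝓘(ℝ, F)) (I.prod 𝓘(ℝ, F))
      (frameEval (𝕜 := 𝕜) (F := F) (V := V)) where
  smooth := contMDiff_frameEval
  surjective v := by
    obtain ⟨⟨a⟩, ha⟩ := (assocToFun_bijective (𝕜 := 𝕜)).surjective v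
    exact ⟨a, ha⟩
  exists_section a := by
    obtain ⟨S, U, hU, ha, hSa, -, hS, hqS⟩ := exists_section_frameEval (I := I) a
    exact ⟨S, _, isOpen_total_preimage hU, ha, hSa, hS, hqS⟩

theorem assocHomeo_mk (a : FrameBundle 𝕜 F V × F) : assocHomeo 𝕜 F V (assocMk a) = frameEval a :=
  rfl

theorem assocHomeo_symm_frameEval (a : FrameBundle 𝕜 F V × F) :
    (assocHomeo 𝕜 F V).symm (frameEval a) = assocMk a :=
  (assocHomeo 𝕜 F V).symm_apply_apply (assocMk a)

variable (𝕜 F V I) in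
theorem hasLocalSections_assocMk :
    HasLocalSections ((I.prod 𝓘(ℝ, F →L[𝕜] F)).prod 𝓘(ℝ, F)) (I.prod 𝓘(ℝ, F))
      (assocMk (𝕜 := 𝕜) (F := F) (V := V)) where
  smooth := ((contMDiff_assocHomeo_symm 𝕜 F V).comp contMDiff_frameEval).congr
    fun a => (assocHomeo_symm_frameEval a).symm
  surjective := Quotient.mk_surjective
  exists_section a := by
    obtain ⟨S, s, hs, ha, hSa, hS, hqS⟩ := (hasLocalSections_frameEval 𝕜 I F V).exists_section a
    refine ⟨S ∘ assocHomeo 𝕜 F V, assocHomeo 𝕜 F V ⁻¹' s,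
      hs.preimage (assocHomeo 𝕜 F V).continuous, ha, hSa,
      hS.comp (contMDiff_assocHomeo 𝕜 F V).contMDiffOn (fun _ h => h), fun y hy => ?_⟩
    exact (assocHomeo 𝕜 F V).injective (hqS _ hy)

/-! ### Fibrewise operations and the bundle `V ×_M V` -/

theorem contMDiff_fibreSMul (c : 𝕜) :
    ContMDiff (I.prod 𝓘(ℝ, F)) (I.prod 𝓘(ℝ, F)) ∞ (fibreSMul 𝕜 F V c) := by
  intro v
  let e := trivializationAt F V v.1
  have he : v.1 ∈ e.baseSet := mem_baseSet_trivializationAt F V _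
  refine (contMDiffAt_total_iff (f := fibreSMul 𝕜 F V c) e he).2
    ⟨(contMDiff_proj V).contMDiffAt, ?_⟩
  have h := contMDiffAt_clm_apply (𝕜 := 𝕜) (A := fun _ => c • ContinuousLinearMap.id 𝕜 F)
    contMDiffAt_const (contMDiffAt_coord (I := I) e he)
  refine h.congr_of_eventuallyEq ?_
  filter_upwards [(isOpen_total_preimage e.open_baseSet).mem_nhds he] with w hw
  exact (Trivialization.linear 𝕜 e hw).map_smul c w.2

theorem prod_total_ext {w w' : TotalSpace (F × F) (V ×ᵇ V)} (h : fibreFst F V w = fibreFst F V w')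
    (h' : fibreSnd F V w = fibreSnd F V w') : w = w' := by
  obtain ⟨m, x, y⟩ := w
  obtain ⟨m', x', y'⟩ := w'
  obtain rfl : m = m' := congrArg TotalSpace.proj h
  obtain rfl : x = x' := TotalSpace.mk_inj.1 h
  obtain rfl : y = y' := TotalSpace.mk_inj.1 h'
  rfl

theorem contMDiffAt_prod_total_iff {f : X → TotalSpace (F × F) (V ×ᵇ V)} {x : X} :
    ContMDiffAt I' (I.prod 𝓘(ℝ, F × F)) ∞ f x ↔
      ContMDiffAt I' (I.prod 𝓘(ℝ, F)) ∞ (fun y => fibreFst F V (f y)) x ∧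
      ContMDiffAt I' (I.prod 𝓘(ℝ, F)) ∞ (fun y => fibreSnd F V (f y)) x := by
  let e := trivializationAt F V (f x).1
  have he : (f x).1 ∈ e.baseSet := mem_baseSet_trivializationAt F V _
  have h1 : ContMDiffAt I' (I.prod 𝓘(ℝ, F × F)) ∞ f x ↔ _ :=
    Trivialization.contMDiffAt_iff (e := e.prod e) (by
      rw [Trivialization.mem_source]; exact ⟨he, he⟩)
  rw [h1, contMDiffAt_total_iff (f := fun y => fibreFst F V (f y)) e he,
    contMDiffAt_total_iff (f := fun y => fibreSnd F V (f y)) e he]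
  have h2 : ContMDiffAt I' 𝓘(ℝ, F × F) ∞ (fun y => (e.prod e (f y)).2) x ↔ _ :=
    contMDiffAt_prod_module_iff _
  rw [h2]
  exact ⟨fun h => ⟨⟨h.1, h.2.1⟩, h.1, h.2.2⟩, fun h => ⟨h.1.1, h.1.2, h.2.2⟩⟩

theorem contMDiff_fibreFst : ContMDiff (I.prod 𝓘(ℝ, F × F)) (I.prod 𝓘(ℝ, F)) ∞ (fibreFst F V) :=
  fun _ => (contMDiffAt_prod_total_iff.1 contMDiffAt_id).1

theorem contMDiff_fibreSnd : ContMDiff (I.prod 𝓘(ℝ, F × F)) (I.prod 𝓘(ℝ, F)) ∞ (fibreSnd F V) :=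
  fun _ => (contMDiffAt_prod_total_iff.1 contMDiffAt_id).2

theorem contMDiff_fibreAdd : ContMDiff (I.prod 𝓘(ℝ, F × F)) (I.prod 𝓘(ℝ, F)) ∞ (fibreAdd F V) := by
  intro w
  let e := trivializationAt F V w.1
  have he : w.1 ∈ e.baseSet := mem_baseSet_trivializationAt F V _
  refine (contMDiffAt_total_iff (f := fibreAdd F V) e he).2
    ⟨(contMDiff_proj (V ×ᵇ V)).contMDiffAt, ?_⟩
  have h1 := (contMDiffAt_coord (I := I) (v := fibreFst F V w) e he).comp w
    contMDiff_fibreFst.contMDiffAt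
  have h2 := (contMDiffAt_coord (I := I) (v := fibreSnd F V w) e he).comp w
    contMDiff_fibreSnd.contMDiffAt
  refine (h1.add h2).congr_of_eventuallyEq ?_
  filter_upwards [(e.open_baseSet.preimage
    (FiberBundle.continuous_proj (F × F) (V ×ᵇ V))).mem_nhds he] with w hw
  exact (Trivialization.linear ℝ e hw).map_add w.2.1 w.2.2

/-- The evaluation map `(f, u₁, u₂) ↦ (f u₁, f u₂)`. -/
def frameEvalPair (a : FrameBundle 𝕜 F V × F × F) : TotalSpace (F × F) (V ×ᵇ V) :=
  ⟨frameProj a.1, (frameMap a.1 a.2.1, frameMap a.1 a.2.2)⟩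

variable (𝕜 F V I) in
theorem contMDiff_frameEvalPair :
    ContMDiff ((I.prod 𝓘(ℝ, F →L[𝕜] F)).prod 𝓘(ℝ, F × F)) (I.prod 𝓘(ℝ, F × F)) ∞
      (frameEvalPair (𝕜 := 𝕜) (F := F) (V := V)) := fun a => by
  refine contMDiffAt_prod_total_iff.2 ⟨?_, ?_⟩
  · exact ContMDiffAt.comp a (g := frameEval) (f := fun a => (a.1, a.2.1))
      (contMDiff_frameEval (I := I)).contMDiffAt
      (contMDiffAt_fst.prodMk (contDiff_fst.contMDiff.contMDiffAt.comp a contMDiffAt_snd))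
  · exact ContMDiffAt.comp a (g := frameEval) (f := fun a => (a.1, a.2.2))
      (contMDiff_frameEval (I := I)).contMDiffAt
      (contMDiffAt_fst.prodMk (contDiff_snd.contMDiff.contMDiffAt.comp a contMDiffAt_snd))

/-! ### Descent of a principal connection -/

/-- The endomorphism `P × id` of the tangent bundle of `F^λ(V) × G`. -/
noncomputable def PrincipalConnection.vertProd {G : Type*} [NormedAddCommGroup G] [NormedSpace ℝ G]
    (P : PrincipalConnection 𝕜 I F V) (a : FrameBundle 𝕜 F V × G) :
    TangentSpace ((I.prod 𝓘(ℝ, F →L[𝕜] F)).prod 𝓘(ℝ, G)) a →L[ℝ]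
      TangentSpace ((I.prod 𝓘(ℝ, F →L[𝕜] F)).prod 𝓘(ℝ, G)) a :=
  ContinuousLinearMap.prodMap (show (E × (F →L[𝕜] F)) →L[ℝ] (E × (F →L[𝕜] F)) from P.vert a.1)
    (ContinuousLinearMap.id ℝ G)

namespace PrincipalConnection

variable (P : PrincipalConnection 𝕜 I F V)

theorem smooth_vertProd :
    ContMDiff ((I.prod 𝓘(ℝ, F →L[𝕜] F)).prod 𝓘(ℝ, F)).tangent
      ((I.prod 𝓘(ℝ, F →L[𝕜] F)).prod 𝓘(ℝ, F)).tangent ∞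
      (fun ξ : TangentBundle ((I.prod 𝓘(ℝ, F →L[𝕜] F)).prod 𝓘(ℝ, F)) (FrameBundle 𝕜 F V × F) =>
        (⟨ξ.1, P.vertProd ξ.1 ξ.2⟩ :
          TangentBundle ((I.prod 𝓘(ℝ, F →L[𝕜] F)).prod 𝓘(ℝ, F)) (FrameBundle 𝕜 F V × F))) := by
  have h := contMDiff_equivTangentBundleProd (n := ∞) (I := I.prod 𝓘(ℝ, F →L[𝕜] F))
    (M := FrameBundle 𝕜 F V) (I' := 𝓘(ℝ, F)) (M' := F)
  have h' := contMDiff_equivTangentBundleProd_symm (n := ∞) (I := I.prod 𝓘(ℝ, F →L[𝕜] F))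
    (M := FrameBundle 𝕜 F V) (I' := 𝓘(ℝ, F)) (M' := F)
  exact h'.comp ((P.smooth.comp (contMDiff_fst.comp h)).prodMk (contMDiff_snd.comp h))

end PrincipalConnection

namespace Connection

variable [IsManifold I' ∞ X] {pr : X → M} (C : Connection I' I pr)

theorem vert_eq_self {x : X} {ξ : TangentSpace I' x} (h : mfderiv I' I pr x ξ = 0) :
    C.vert x ξ = ξ := by
  obtain ⟨η, rfl⟩ : ξ ∈ Set.range (C.vert x) := by rw [C.range_vert]; exact h
  exact C.idempotent x η

theorem mfderiv_proj_vert (x : X) (ξ : TangentSpace I' x) :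
    mfderiv I' I pr x (C.vert x ξ) = 0 := by
  have : C.vert x ξ ∈ Set.range (C.vert x) := ⟨ξ, rfl⟩
  rw [C.range_vert] at this
  exact this

end Connection

/-- Differentiate `pr ∘ q = frameProj ∘ fst`. Consequently a vector killed by `Tq`, or sent by it to
a vertical vector, has a vertical frame component. -/
theorem mfderiv_proj_of_comp_fst {pr : X → M} {q : FrameBundle 𝕜 F V × F → X}
    (hq : ContMDiff ((I.prod 𝓘(ℝ, F →L[𝕜] F)).prod 𝓘(ℝ, F)) I' ∞ q)
    (hpr : ContMDiff I' I ∞ pr) (h : ∀ a, pr (q a) = frameProj a.1) (a : FrameBundle 𝕜 F V × F)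
    (ζ : TangentSpace ((I.prod 𝓘(ℝ, F →L[𝕜] F)).prod 𝓘(ℝ, F)) a) :
    (mfderiv I' I pr (q a) (mfderiv ((I.prod 𝓘(ℝ, F →L[𝕜] F)).prod 𝓘(ℝ, F)) I' q a ζ) : E) =
      (mfderiv (I.prod 𝓘(ℝ, F →L[𝕜] F)) I frameProj a.1 ζ.1 : E) := by
  refine (mfderiv_mfderiv_eq rfl (hpr.mdifferentiableAt (by simp)) (hq.mdifferentiableAt (by simp))
    (Filter.Eventually.of_forall h) ζ).trans ?_
  refine (mfderiv_mfderiv_eq rfl (contMDiff_frameProj.mdifferentiableAt (by simp))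
    mdifferentiableAt_fst (Filter.Eventually.of_forall fun _ => rfl) ζ).symm.trans ?_
  rw [mfderiv_fst]
  rfl

/-- The action of `g` on `F^λ(V) × F`. -/
def assocAct (g : F ≃L[𝕜] F) : FrameBundle 𝕜 F V × F → FrameBundle 𝕜 F V × F :=
  Prod.map (frameAct g) g.symm

theorem contDiff_equiv (g : F ≃L[𝕜] F) : ContDiff ℝ ∞ g :=
  (g.restrictScalars ℝ).contDiff

theorem contMDiff_assocAct (g : F ≃L[𝕜] F) :
    ContMDiff ((I.prod 𝓘(ℝ, F →L[𝕜] F)).prod 𝓘(ℝ, F)) ((I.prod 𝓘(ℝ, F →L[𝕜] F)).prod 𝓘(ℝ, F)) ∞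
      (assocAct (V := V) g) :=
  (contMDiff_frameAct g).prodMap (contDiff_equiv g.symm).contMDiff

theorem frameEval_assocAct (g : F ≃L[𝕜] F) (a : FrameBundle 𝕜 F V × F) :
    frameEval (assocAct g a) = frameEval a := by
  change (⟨frameProj a.1, frameMap a.1 (g (g.symm a.2))⟩ : TotalSpace F V) = _
  rw [g.apply_symm_apply]
  rfl

/-- Injectivity of `θ`: the fibres of the evaluation map are single orbits. -/
theorem exists_assocAct_of_frameEval_eq {a b : FrameBundle 𝕜 F V × F}
    (h : frameEval a = frameEval b) : ∃ g : F ≃L[𝕜] F, b = assocAct g a := by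
  have h1 : assocMk a = assocMk b := assocToFun_bijective.injective h
  exact Quotient.exact h1

theorem PrincipalConnection.vertProd_assocAct (P : PrincipalConnection 𝕜 I F V) (g : F ≃L[𝕜] F)
    (a : FrameBundle 𝕜 F V × F) (ζ : TangentSpace ((I.prod 𝓘(ℝ, F →L[𝕜] F)).prod 𝓘(ℝ, F)) a) :
    P.vertProd (assocAct g a) (mfderiv ((I.prod 𝓘(ℝ, F →L[𝕜] F)).prod 𝓘(ℝ, F))
      ((I.prod 𝓘(ℝ, F →L[𝕜] F)).prod 𝓘(ℝ, F)) (assocAct g) a ζ) =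
    mfderiv ((I.prod 𝓘(ℝ, F →L[𝕜] F)).prod 𝓘(ℝ, F))
      ((I.prod 𝓘(ℝ, F →L[𝕜] F)).prod 𝓘(ℝ, F)) (assocAct g) a (P.vertProd a ζ) := by
  have h : mfderiv ((I.prod 𝓘(ℝ, F →L[𝕜] F)).prod 𝓘(ℝ, F))
      ((I.prod 𝓘(ℝ, F →L[𝕜] F)).prod 𝓘(ℝ, F)) (assocAct (V := V) g) a = _ :=
    mfderiv_prodMap ((contMDiff_frameAct g).mdifferentiableAt (by simp))
      ((contDiff_equiv g.symm).contMDiff.mdifferentiableAt (by simp))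
  rw [h]
  exact Prod.ext (P.equivariant g a.1 ζ.1) rfl

theorem mfderiv_frameEval_assocAct (g : F ≃L[𝕜] F) (a : FrameBundle 𝕜 F V × F)
    (ζ : TangentSpace ((I.prod 𝓘(ℝ, F →L[𝕜] F)).prod 𝓘(ℝ, F)) a) :
    (mfderiv ((I.prod 𝓘(ℝ, F →L[𝕜] F)).prod 𝓘(ℝ, F)) (I.prod 𝓘(ℝ, F)) frameEval (assocAct g a)
      (mfderiv ((I.prod 𝓘(ℝ, F →L[𝕜] F)).prod 𝓘(ℝ, F))
        ((I.prod 𝓘(ℝ, F →L[𝕜] F)).prod 𝓘(ℝ, F)) (assocAct g) a ζ) : E × F) =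
    (mfderiv ((I.prod 𝓘(ℝ, F →L[𝕜] F)).prod 𝓘(ℝ, F)) (I.prod 𝓘(ℝ, F)) frameEval a ζ : E × F) :=
  mfderiv_mfderiv_eq rfl (contMDiff_frameEval.mdifferentiableAt (by simp))
    ((contMDiff_assocAct g).mdifferentiableAt (by simp))
    (Filter.Eventually.of_forall fun x => frameEval_assocAct g x) ζ

/-- The difference `ξ - η` is in the kernel of `T ev`, so its frame component is vertical and `P ×
id` leaves it unchanged, still in the kernel. -/
theorem PrincipalConnection.mfderiv_frameEval_vertProd_congr (P : PrincipalConnection 𝕜 I F V)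
    (c : FrameBundle 𝕜 F V × F) (ξ η : TangentSpace ((I.prod 𝓘(ℝ, F →L[𝕜] F)).prod 𝓘(ℝ, F)) c)
    (h : mfderiv ((I.prod 𝓘(ℝ, F →L[𝕜] F)).prod 𝓘(ℝ, F)) (I.prod 𝓘(ℝ, F)) frameEval c ξ =
      mfderiv ((I.prod 𝓘(ℝ, F →L[𝕜] F)).prod 𝓘(ℝ, F)) (I.prod 𝓘(ℝ, F)) frameEval c η) :
    mfderiv ((I.prod 𝓘(ℝ, F →L[𝕜] F)).prod 𝓘(ℝ, F)) (I.prod 𝓘(ℝ, F)) frameEval c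
        (P.vertProd c ξ) =
      mfderiv ((I.prod 𝓘(ℝ, F →L[𝕜] F)).prod 𝓘(ℝ, F)) (I.prod 𝓘(ℝ, F)) frameEval c
        (P.vertProd c η) := by
  have h3 : mfderiv ((I.prod 𝓘(ℝ, F →L[𝕜] F)).prod 𝓘(ℝ, F)) (I.prod 𝓘(ℝ, F)) frameEval c
      (ξ - η) = 0 := by
    rw [map_sub]; exact sub_eq_zero.2 h
  have h4 : P.vertProd c (ξ - η) = ξ - η := by
    refine Prod.ext (P.vert_eq_self ?_) rfl
    refine (mfderiv_proj_of_comp_fst contMDiff_frameEval (contMDiff_proj V) (fun _ => rfl) c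
      _).symm.trans ?_
    rw [h3]
    exact map_zero _
  have h5 := h3
  rw [← h4, map_sub, map_sub] at h5
  exact sub_eq_zero.1 h5

/-- The two base points differ by some `g`. Moving `ξ` by `T(assocAct g)` does not alter its image
under `T ev` and commutes with `P × id`, which reduces the claim to vectors at one point. -/
theorem PrincipalConnection.vertProd_compat (P : PrincipalConnection 𝕜 I F V)
    (ξ η : TangentBundle ((I.prod 𝓘(ℝ, F →L[𝕜] F)).prod 𝓘(ℝ, F)) (FrameBundle 𝕜 F V × F))
    (h : tangentMap ((I.prod 𝓘(ℝ, F →L[𝕜] F)).prod 𝓘(ℝ, F)) (I.prod 𝓘(ℝ, F)) frameEval ξ =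
      tangentMap ((I.prod 𝓘(ℝ, F →L[𝕜] F)).prod 𝓘(ℝ, F)) (I.prod 𝓘(ℝ, F)) frameEval η) :
    tangentMap ((I.prod 𝓘(ℝ, F →L[𝕜] F)).prod 𝓘(ℝ, F)) (I.prod 𝓘(ℝ, F)) frameEval
        ⟨ξ.1, P.vertProd ξ.1 ξ.2⟩ =
      tangentMap ((I.prod 𝓘(ℝ, F →L[𝕜] F)).prod 𝓘(ℝ, F)) (I.prod 𝓘(ℝ, F)) frameEval
        ⟨η.1, P.vertProd η.1 η.2⟩ := by
  obtain ⟨a, ξ⟩ := ξ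
  obtain ⟨b, η⟩ := η
  have hab : frameEval a = frameEval b := congrArg TotalSpace.proj h
  obtain ⟨g, rfl⟩ := exists_assocAct_of_frameEval_eq hab
  have h2 := (mfderiv_frameEval_assocAct g a ξ).trans (tangentBundle_snd_eq h)
  refine tangentBundle_mk_eq hab ((mfderiv_frameEval_assocAct g a (P.vertProd a ξ)).symm.trans ?_)
  refine (congrArg _ (P.vertProd_assocAct g a ξ).symm).trans ?_
  exact P.mfderiv_frameEval_vertProd_congr _ _ _ h2

variable (𝕜 F V I) in
theorem contMDiff_assocProj : ContMDiff (I.prod 𝓘(ℝ, F)) I ∞ (assocProj 𝕜 F V) :=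
  ((contMDiff_proj V).comp (contMDiff_assocHomeo 𝕜 F V)).congr fun b => by
    obtain ⟨a, rfl⟩ := Quotient.mk_surjective b
    rfl

/-- A principal connection descends to every quotient of `F^λ(V) × F` by the action. -/
theorem PrincipalConnection.exists_connection [IsManifold I' ∞ X]
    (P : PrincipalConnection 𝕜 I F V) {pr : X → M}
    {q : FrameBundle 𝕜 F V × F → X}
    (hq : HasLocalSections ((I.prod 𝓘(ℝ, F →L[𝕜] F)).prod 𝓘(ℝ, F)) I' q)
    (hpr : ContMDiff I' I ∞ pr) (h : ∀ a, pr (q a) = frameProj a.1)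
    {θ : X → TotalSpace F V} (hθ : ContMDiff I' (I.prod 𝓘(ℝ, F)) ∞ θ)
    {θ' : TotalSpace F V → X} (hθ' : ContMDiff (I.prod 𝓘(ℝ, F)) I' ∞ θ')
    (hqθ : ∀ a, θ (q a) = frameEval a) (hqθ' : ∀ a, θ' (frameEval a) = q a) :
    ∃ B : Connection I' I pr, ∀ a (ζ : TangentSpace ((I.prod 𝓘(ℝ, F →L[𝕜] F)).prod 𝓘(ℝ, F)) a),
      B.vert (q a) (mfderiv ((I.prod 𝓘(ℝ, F →L[𝕜] F)).prod 𝓘(ℝ, F)) I' q a ζ) =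
        mfderiv ((I.prod 𝓘(ℝ, F →L[𝕜] F)).prod 𝓘(ℝ, F)) I' q a (P.vertProd a ζ) := by
  have hev := contMDiff_frameEval (𝕜 := 𝕜) (V := V) (I := I) (F := F)
  -- Since `ev = θ ∘ q` and `q = θ' ∘ ev`, the maps `T ev` and `Tq` identify the same pairs of
  -- vectors, so the compatibility proved for `ev` applies to `q`.
  have t1 : ∀ ξ, tangentMap ((I.prod 𝓘(ℝ, F →L[𝕜] F)).prod 𝓘(ℝ, F)) (I.prod 𝓘(ℝ, F)) frameEval ξ =
      tangentMap I' (I.prod 𝓘(ℝ, F)) θ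
        (tangentMap ((I.prod 𝓘(ℝ, F →L[𝕜] F)).prod 𝓘(ℝ, F)) I' q ξ) := fun ξ => by
    have h1 : frameEval = θ ∘ q := funext fun a => (hqθ a).symm
    rw [h1, tangentMap_comp_at _ (hθ.mdifferentiableAt (by simp))
      (hq.smooth.mdifferentiableAt (by simp))]
  have t2 : ∀ ξ, tangentMap ((I.prod 𝓘(ℝ, F →L[𝕜] F)).prod 𝓘(ℝ, F)) I' q ξ =
      tangentMap (I.prod 𝓘(ℝ, F)) I' θ'
        (tangentMap ((I.prod 𝓘(ℝ, F →L[𝕜] F)).prod 𝓘(ℝ, F)) (I.prod 𝓘(ℝ, F)) frameEval ξ) :=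
    fun ξ => by
    have h1 : q = θ' ∘ frameEval := funext fun a => (hqθ' a).symm
    rw [h1, tangentMap_comp_at _ (hθ'.mdifferentiableAt (by simp))
      (hev.mdifferentiableAt (by simp))]
  obtain ⟨C, hC, hqC⟩ := exists_descent hq P.vertProd P.smooth_vertProd (fun ξ η hξη => by
    rw [t2, t2]
    refine congrArg _ (P.vertProd_compat ξ η ?_)
    rw [t1, t1, hξη])
  refine ⟨⟨C, ?_, ?_, hC⟩, hqC⟩
  · intro x ξ
    obtain ⟨a, rfl⟩ := hq.surjective x
    obtain ⟨ζ, rfl⟩ := hq.surjective_mfderiv a ξ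
    rw [hqC, hqC]
    congr 1
    exact Prod.ext (P.idempotent a.1 ζ.1) rfl
  · intro x
    obtain ⟨a, rfl⟩ := hq.surjective x
    ext ξ
    obtain ⟨ζ, rfl⟩ := hq.surjective_mfderiv a ξ
    constructor
    · rintro ⟨ξ', hξ'⟩
      obtain ⟨ζ', rfl⟩ := hq.surjective_mfderiv a ξ'
      rw [← hξ', hqC]
      exact (mfderiv_proj_of_comp_fst hq.smooth hpr h a _).trans (P.mfderiv_proj_vert _ _)
    · intro h0
      -- A vertical vector is `Tq ζ` with vertical frame component, so `P × id` fixes `ζ` and the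
      -- vector is its own image.
      refine ⟨_, (hqC a ζ).trans (congrArg _ ?_)⟩
      refine Prod.ext (P.vert_eq_self ?_) rfl
      exact (mfderiv_proj_of_comp_fst hq.smooth hpr h a ζ).symm.trans h0

theorem PrincipalConnection.existsUnique_isInduced (P : PrincipalConnection 𝕜 I F V) :
    ∃! B : Connection (I.prod 𝓘(ℝ, F)) I (assocProj 𝕜 F V), IsInduced P B := by
  have hq := hasLocalSections_assocMk 𝕜 I F V
  obtain ⟨B, hB⟩ := P.exists_connection hq (contMDiff_assocProj 𝕜 I F V) (fun _ => rfl)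
    (contMDiff_assocHomeo 𝕜 F V) (contMDiff_assocHomeo_symm 𝕜 F V) assocHomeo_mk
    assocHomeo_symm_frameEval
  refine ⟨B, fun a ξ η => hB a (ξ, η), fun B' hB' => ?_⟩
  ext x ξ
  obtain ⟨a, rfl⟩ := hq.surjective x
  obtain ⟨ζ, rfl⟩ := hq.surjective_mfderiv a ξ
  exact (hB' a ζ.1 ζ.2).trans (hB a ζ).symm

/-! ### Linearity of the descended connection on the fibres of `Tπ` -/

theorem tangentMap_comm {E₁ E₂ E₃ E₄ : Type*} [NormedAddCommGroup E₁] [NormedSpace ℝ E₁]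
    [NormedAddCommGroup E₂] [NormedSpace ℝ E₂] [NormedAddCommGroup E₃] [NormedSpace ℝ E₃]
    [NormedAddCommGroup E₄] [NormedSpace ℝ E₄] {H₁ H₂ H₃ H₄ : Type*} [TopologicalSpace H₁]
    [TopologicalSpace H₂] [TopologicalSpace H₃] [TopologicalSpace H₄]
    {I₁ : ModelWithCorners ℝ E₁ H₁} {I₂ : ModelWithCorners ℝ E₂ H₂}
    {I₃ : ModelWithCorners ℝ E₃ H₃} {I₄ : ModelWithCorners ℝ E₄ H₄}
    {X₁ X₂ X₃ X₄ : Type*} [TopologicalSpace X₁] [ChartedSpace H₁ X₁] [TopologicalSpace X₂]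
    [ChartedSpace H₂ X₂] [TopologicalSpace X₃] [ChartedSpace H₃ X₃] [TopologicalSpace X₄]
    [ChartedSpace H₄ X₄] {f : X₁ → X₂} {g : X₂ → X₄} {f' : X₁ → X₃} {g' : X₃ → X₄}
    (hf : ContMDiff I₁ I₂ ∞ f) (hg : ContMDiff I₂ I₄ ∞ g) (hf' : ContMDiff I₁ I₃ ∞ f')
    (hg' : ContMDiff I₃ I₄ ∞ g') (h : ∀ x, g (f x) = g' (f' x)) (ξ : TangentBundle I₁ X₁) :
    tangentMap I₂ I₄ g (tangentMap I₁ I₂ f ξ) = tangentMap I₃ I₄ g' (tangentMap I₁ I₃ f' ξ) := by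
  rw [← tangentMap_comp_at ξ (hg.mdifferentiableAt (by simp)) (hf.mdifferentiableAt (by simp)),
    ← tangentMap_comp_at ξ (hg'.mdifferentiableAt (by simp)) (hf'.mdifferentiableAt (by simp)),
    show g ∘ f = g' ∘ f' from funext h]

/-- The vertical projection of a connection, as a map of tangent bundles. -/
noncomputable def Connection.total [IsManifold I' ∞ X] {pr : X → M} (C : Connection I' I pr)
    (ξ : TangentBundle I' X) : TangentBundle I' X :=
  ⟨ξ.1, C.vert ξ.1 ξ.2⟩

section
variable {G G' : Type*} [NormedAddCommGroup G] [NormedSpace ℝ G] [NormedAddCommGroup G']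
  [NormedSpace ℝ G']

/-- `P × id` as a map of tangent bundles. -/
noncomputable def PrincipalConnection.totalProd (P : PrincipalConnection 𝕜 I F V)
    (ξ : TangentBundle ((I.prod 𝓘(ℝ, F →L[𝕜] F)).prod 𝓘(ℝ, G)) (FrameBundle 𝕜 F V × G)) :
    TangentBundle ((I.prod 𝓘(ℝ, F →L[𝕜] F)).prod 𝓘(ℝ, G)) (FrameBundle 𝕜 F V × G) :=
  ⟨ξ.1, P.vertProd ξ.1 ξ.2⟩

variable (𝕜 F V) in
/-- The map `id × L` of `F^λ(V) × G`. -/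
def frameProdMap (L : G →L[ℝ] G') : FrameBundle 𝕜 F V × G → FrameBundle 𝕜 F V × G' :=
  Prod.map id L

variable (𝕜 F V I) in
theorem contMDiff_frameProdMap (L : G →L[ℝ] G') :
    ContMDiff ((I.prod 𝓘(ℝ, F →L[𝕜] F)).prod 𝓘(ℝ, G)) ((I.prod 𝓘(ℝ, F →L[𝕜] F)).prod 𝓘(ℝ, G')) ∞
      (frameProdMap 𝕜 F V L) :=
  contMDiff_id.prodMap L.contDiff.contMDiff

/-- The two maps act on different factors of the product. -/
theorem PrincipalConnection.totalProd_tangentMap (P : PrincipalConnection 𝕜 I F V)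
    (L : G →L[ℝ] G')
    (ξ : TangentBundle ((I.prod 𝓘(ℝ, F →L[𝕜] F)).prod 𝓘(ℝ, G)) (FrameBundle 𝕜 F V × G)) :
    P.totalProd (tangentMap ((I.prod 𝓘(ℝ, F →L[𝕜] F)).prod 𝓘(ℝ, G))
        ((I.prod 𝓘(ℝ, F →L[𝕜] F)).prod 𝓘(ℝ, G')) (frameProdMap 𝕜 F V L) ξ) =
      tangentMap ((I.prod 𝓘(ℝ, F →L[𝕜] F)).prod 𝓘(ℝ, G))
        ((I.prod 𝓘(ℝ, F →L[𝕜] F)).prod 𝓘(ℝ, G')) (frameProdMap 𝕜 F V L) (P.totalProd ξ) := by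
  obtain ⟨a, ξ⟩ := ξ
  have h : mfderiv ((I.prod 𝓘(ℝ, F →L[𝕜] F)).prod 𝓘(ℝ, G))
        ((I.prod 𝓘(ℝ, F →L[𝕜] F)).prod 𝓘(ℝ, G')) (frameProdMap 𝕜 F V L) a = _ :=
    mfderiv_prodMap mdifferentiableAt_id
      (L.contDiff.contMDiff (n := ∞) |>.mdifferentiableAt (by simp))
  refine tangentBundle_mk_eq rfl ?_
  change P.vertProd _ (mfderiv ((I.prod 𝓘(ℝ, F →L[𝕜] F)).prod 𝓘(ℝ, G))
        ((I.prod 𝓘(ℝ, F →L[𝕜] F)).prod 𝓘(ℝ, G')) (frameProdMap 𝕜 F V L) a ξ) =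
      mfderiv ((I.prod 𝓘(ℝ, F →L[𝕜] F)).prod 𝓘(ℝ, G))
        ((I.prod 𝓘(ℝ, F →L[𝕜] F)).prod 𝓘(ℝ, G')) (frameProdMap 𝕜 F V L) a (P.vertProd a ξ)
  rw [h, mfderiv_id]
  rfl

end

/-- Lift both vectors with a section of `ev` whose frame depends only on the base point, and use the
frame of the first. Defining the lift on all of `V × V`, not only on `V ×_M V`, lets its derivative
be applied to a pair of tangent vectors of `V`. -/
theorem exists_frameEvalPair_lift (w : TotalSpace (F × F) (V ×ᵇ V)) :
    ∃ S : TotalSpace F V × TotalSpace F V → FrameBundle 𝕜 F V × F × F,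
      ContMDiffAt ((I.prod 𝓘(ℝ, F)).prod (I.prod 𝓘(ℝ, F)))
        ((I.prod 𝓘(ℝ, F →L[𝕜] F)).prod 𝓘(ℝ, F × F)) ∞ S (fibreFst F V w, fibreSnd F V w) ∧
      ∀ᶠ w' in 𝓝 w, frameEvalPair (S (fibreFst F V w', fibreSnd F V w')) = w' := by
  obtain ⟨a, ha⟩ := (hasLocalSections_frameEval 𝕜 I F V).surjective (fibreFst F V w)
  obtain ⟨S, U, hU, haU, -, hS1, hS, hqS⟩ := exists_section_frameEval (I := I) a
  have haw : frameProj a.1 = w.1 := congrArg TotalSpace.proj ha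
  rw [haw] at haU
  have hn : ∀ v : TotalSpace F V, v.1 ∈ U → ContMDiffAt (I.prod 𝓘(ℝ, F))
      ((I.prod 𝓘(ℝ, F →L[𝕜] F)).prod 𝓘(ℝ, F)) ∞ S v := fun v hv =>
    hS.contMDiffAt ((isOpen_total_preimage hU).mem_nhds hv)
  refine ⟨fun v => ((S v.1).1, (S v.1).2, (S v.2).2), ?_, ?_⟩
  · have h1 := (hn (fibreFst F V w) haU).comp (fibreFst F V w, fibreSnd F V w)
      (contMDiffAt_fst (J := I.prod 𝓘(ℝ, F)))
    have h2 := (hn (fibreSnd F V w) haU).comp (fibreFst F V w, fibreSnd F V w)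
      (contMDiffAt_snd (I := I.prod 𝓘(ℝ, F)))
    exact (contMDiffAt_fst.comp _ h1).prodMk
      ((contMDiffAt_snd.comp _ h1).prodMk_space (contMDiffAt_snd.comp _ h2))
  · filter_upwards [(hU.preimage
      (FiberBundle.continuous_proj (F × F) (V ×ᵇ V))).mem_nhds haU] with w' hw'
    refine prod_total_ext (hqS (fibreFst F V w') hw') ?_
    refine Eq.trans ?_ (hqS (fibreSnd F V w') hw')
    change frameEval ((S (fibreFst F V w')).1, (S (fibreSnd F V w')).2) = _
    rw [hS1 (fibreFst F V w') (fibreSnd F V w') rfl]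

-- Differentiate the identity satisfied by the lift near `w`. As `T` sees only the two components of
-- `ζ`, this yields both the surjectivity of the tangent map of `frameEvalPair` and the fact that
-- `ζ` is determined by its components.
variable (𝕜) in
theorem tangentMap_frameEvalPair (w : TotalSpace (F × F) (V ×ᵇ V)) :
    ∃ T : E × F → E × F → TangentBundle ((I.prod 𝓘(ℝ, F →L[𝕜] F)).prod 𝓘(ℝ, F × F))
        (FrameBundle 𝕜 F V × F × F),
      ∀ ζ : TangentSpace (I.prod 𝓘(ℝ, F × F)) w,
        tangentMap ((I.prod 𝓘(ℝ, F →L[𝕜] F)).prod 𝓘(ℝ, F × F)) (I.prod 𝓘(ℝ, F × F)) frameEvalPair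
          (T (mfderiv (I.prod 𝓘(ℝ, F × F)) (I.prod 𝓘(ℝ, F)) (fibreFst F V) w ζ)
            (mfderiv (I.prod 𝓘(ℝ, F × F)) (I.prod 𝓘(ℝ, F)) (fibreSnd F V) w ζ)) = ⟨w, ζ⟩ := by
  obtain ⟨S, hS, hw⟩ := exists_frameEvalPair_lift (𝕜 := 𝕜) (I := I) w
  refine ⟨fun ζ₁ ζ₂ => ⟨S (fibreFst F V w, fibreSnd F V w),
    mfderiv ((I.prod 𝓘(ℝ, F)).prod (I.prod 𝓘(ℝ, F)))
        ((I.prod 𝓘(ℝ, F →L[𝕜] F)).prod 𝓘(ℝ, F × F)) S (fibreFst F V w, fibreSnd F V w)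
        (ζ₁, ζ₂)⟩, fun ζ => tangentBundle_mk_eq hw.self_of_nhds ?_⟩
  have h1 : MDifferentiableAt (I.prod 𝓘(ℝ, F × F)) (I.prod 𝓘(ℝ, F)) (fibreFst F V) w :=
    contMDiff_fibreFst.mdifferentiableAt (by simp)
  have h2 : MDifferentiableAt (I.prod 𝓘(ℝ, F × F)) (I.prod 𝓘(ℝ, F)) (fibreSnd F V) w :=
    contMDiff_fibreSnd.mdifferentiableAt (by simp)
  have hS' := hS.mdifferentiableAt (by simp)
  have h3 := mfderiv_mfderiv_eq (f := fun w => (fibreFst F V w, fibreSnd F V w)) rfl hS'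
    (h1.prodMk h2) (Filter.Eventually.of_forall fun _ => rfl) ζ
  rw [mfderiv_prodMk h1 h2] at h3
  have h4 := mfderiv_mfderiv_eq (x := w) (g := frameEvalPair) rfl
    ((contMDiff_frameEvalPair 𝕜 I F V).mdifferentiableAt (by simp))
    (MDifferentiableAt.comp w hS' (h1.prodMk h2)) hw ζ
  refine Eq.trans ?_ (h4.trans (mfderiv_id_of_eventually (by simp) ζ))
  exact congrArg (mfderiv ((I.prod 𝓘(ℝ, F →L[𝕜] F)).prod 𝓘(ℝ, F × F)) (I.prod 𝓘(ℝ, F × F))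
    frameEvalPair (S (fibreFst F V w, fibreSnd F V w))) h3

theorem tangentBundle_prod_ext
    {ξ η : TangentBundle (I.prod 𝓘(ℝ, F × F)) (TotalSpace (F × F) (V ×ᵇ V))}
    (h1 : tangentMap (I.prod 𝓘(ℝ, F × F)) (I.prod 𝓘(ℝ, F)) (fibreFst F V) ξ =
      tangentMap (I.prod 𝓘(ℝ, F × F)) (I.prod 𝓘(ℝ, F)) (fibreFst F V) η)
    (h2 : tangentMap (I.prod 𝓘(ℝ, F × F)) (I.prod 𝓘(ℝ, F)) (fibreSnd F V) ξ =
      tangentMap (I.prod 𝓘(ℝ, F × F)) (I.prod 𝓘(ℝ, F)) (fibreSnd F V) η) : ξ = η := by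
  obtain ⟨w, ξ⟩ := ξ
  obtain ⟨w', η⟩ := η
  obtain rfl : w = w' :=
    prod_total_ext (congrArg TotalSpace.proj h1) (congrArg TotalSpace.proj h2)
  -- The statement involves no scalar field `𝕜`, so real frames are used.
  obtain ⟨T, hT⟩ := tangentMap_frameEvalPair ℝ (I := I) w
  rw [← hT ξ, ← hT η]
  exact congrArg _ (congrArg₂ T (tangentBundle_snd_eq h1) (tangentBundle_snd_eq h2))

/-- `A ∘ T ev = T ev ∘ (P × id)`, with `ev : F^λ(V) × F → V` the evaluation map. -/
def Intertwines (P : PrincipalConnection 𝕜 I F V)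
    (A : Connection (I.prod 𝓘(ℝ, F)) I (TotalSpace.proj : TotalSpace F V → M)) : Prop :=
  ∀ ζ : TangentBundle ((I.prod 𝓘(ℝ, F →L[𝕜] F)).prod 𝓘(ℝ, F)) (FrameBundle 𝕜 F V × F),
    A.total (tangentMap ((I.prod 𝓘(ℝ, F →L[𝕜] F)).prod 𝓘(ℝ, F)) (I.prod 𝓘(ℝ, F)) frameEval ζ) =
      tangentMap ((I.prod 𝓘(ℝ, F →L[𝕜] F)).prod 𝓘(ℝ, F)) (I.prod 𝓘(ℝ, F)) frameEval
        (P.totalProd ζ)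

namespace Intertwines

variable {P : PrincipalConnection 𝕜 I F V}
  {A : Connection (I.prod 𝓘(ℝ, F)) I (TotalSpace.proj : TotalSpace F V → M)}

/-- Every vector is of the form `T ev ζ`, and `c • f u = f (c • u)` lifts the scalar multiplication
to `id × c`, which commutes with `P × id`. -/
theorem map_smul (h : Intertwines P A) (c : 𝕜)
    (ξ : TangentBundle (I.prod 𝓘(ℝ, F)) (TotalSpace F V)) :
    A.total (tangentMap (I.prod 𝓘(ℝ, F)) (I.prod 𝓘(ℝ, F)) (fibreSMul 𝕜 F V c) ξ) =
      tangentMap (I.prod 𝓘(ℝ, F)) (I.prod 𝓘(ℝ, F)) (fibreSMul 𝕜 F V c) (A.total ξ) := by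
  have hq := hasLocalSections_frameEval 𝕜 I F V
  obtain ⟨ζ, rfl⟩ : ∃ ζ, tangentMap ((I.prod 𝓘(ℝ, F →L[𝕜] F)).prod 𝓘(ℝ, F)) (I.prod 𝓘(ℝ, F))
      frameEval ζ = ξ := by
    obtain ⟨v, ξ⟩ := ξ
    obtain ⟨a, rfl⟩ := hq.surjective v
    obtain ⟨ζ, rfl⟩ := hq.surjective_mfderiv a ξ
    exact ⟨⟨a, ζ⟩, rfl⟩
  let L : F →L[ℝ] F := (c • ContinuousLinearMap.id 𝕜 F).restrictScalars ℝ
  have hc := fun ζ => tangentMap_comm (contMDiff_frameEval (I := I))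
    (contMDiff_fibreSMul (V := V) c)
    (contMDiff_frameProdMap 𝕜 I F V L) contMDiff_frameEval (fun a => by
      change (⟨frameProj a.1, c • frameMap a.1 a.2⟩ : TotalSpace F V) =
        ⟨frameProj a.1, frameMap a.1 (c • a.2)⟩
      rw [_root_.map_smul]) ζ
  rw [hc, h, P.totalProd_tangentMap, ← hc, h]

/-- Addition lifts to `id × (fst + snd)` on `F^λ(V) × F × F`. -/
theorem map_add (h : Intertwines P A)
    {ζ ζ' : TangentBundle (I.prod 𝓘(ℝ, F × F)) (TotalSpace (F × F) (V ×ᵇ V))}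
    (h1 : tangentMap (I.prod 𝓘(ℝ, F × F)) (I.prod 𝓘(ℝ, F)) (fibreFst F V) ζ' =
      A.total (tangentMap (I.prod 𝓘(ℝ, F × F)) (I.prod 𝓘(ℝ, F)) (fibreFst F V) ζ))
    (h2 : tangentMap (I.prod 𝓘(ℝ, F × F)) (I.prod 𝓘(ℝ, F)) (fibreSnd F V) ζ' =
      A.total (tangentMap (I.prod 𝓘(ℝ, F × F)) (I.prod 𝓘(ℝ, F)) (fibreSnd F V) ζ)) :
    A.total (tangentMap (I.prod 𝓘(ℝ, F × F)) (I.prod 𝓘(ℝ, F)) (fibreAdd F V) ζ) =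
      tangentMap (I.prod 𝓘(ℝ, F × F)) (I.prod 𝓘(ℝ, F)) (fibreAdd F V) ζ' := by
  obtain ⟨z, rfl⟩ : ∃ z, tangentMap ((I.prod 𝓘(ℝ, F →L[𝕜] F)).prod 𝓘(ℝ, F × F))
      (I.prod 𝓘(ℝ, F × F)) (frameEvalPair (𝕜 := 𝕜)) z = ζ := by
    obtain ⟨T, hT⟩ := tangentMap_frameEvalPair 𝕜 (I := I) ζ.1
    exact ⟨_, hT ζ.2⟩
  have hp := contMDiff_frameEvalPair 𝕜 I F V
  have c1 := fun z => tangentMap_comm hp contMDiff_fibreFst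
    (contMDiff_frameProdMap 𝕜 I F V (ContinuousLinearMap.fst ℝ F F)) contMDiff_frameEval
    (fun a => rfl) z
  have c2 := fun z => tangentMap_comm hp contMDiff_fibreSnd
    (contMDiff_frameProdMap 𝕜 I F V (ContinuousLinearMap.snd ℝ F F)) contMDiff_frameEval
    (fun a => rfl) z
  have c3 := fun z => tangentMap_comm hp contMDiff_fibreAdd
    (contMDiff_frameProdMap 𝕜 I F V
      (ContinuousLinearMap.fst ℝ F F + ContinuousLinearMap.snd ℝ F F)) contMDiff_frameEval
    (fun a => by
      change (⟨frameProj a.1, frameMap a.1 a.2.1 + frameMap a.1 a.2.2⟩ : TotalSpace F V) =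
        ⟨frameProj a.1, frameMap a.1 (a.2.1 + a.2.2)⟩
      rw [_root_.map_add]) z
  -- The hypotheses prescribe both components of `ζ'`, and the right-hand side has the same
  -- components.
  have hz : ζ' = tangentMap ((I.prod 𝓘(ℝ, F →L[𝕜] F)).prod 𝓘(ℝ, F × F))
      (I.prod 𝓘(ℝ, F × F)) (frameEvalPair (𝕜 := 𝕜)) (P.totalProd z) := by
    refine tangentBundle_prod_ext ?_ ?_
    · rw [h1, c1, c1, h, P.totalProd_tangentMap]
    · rw [h2, c2, c2, h, P.totalProd_tangentMap]
  rw [hz, c3, c3, h, P.totalProd_tangentMap]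

theorem unique (h : Intertwines P A)
    {A' : Connection (I.prod 𝓘(ℝ, F)) I (TotalSpace.proj : TotalSpace F V → M)}
    (h' : Intertwines P A') : A = A' := by
  have hq := hasLocalSections_frameEval 𝕜 I F V
  ext v ξ
  obtain ⟨a, rfl⟩ := hq.surjective v
  obtain ⟨ζ, rfl⟩ := hq.surjective_mfderiv a ξ
  exact tangentBundle_snd_eq ((h ⟨a, ζ⟩).trans (h' ⟨a, ζ⟩).symm)

end Intertwines

theorem PrincipalConnection.existsUnique_affine (P : PrincipalConnection 𝕜 I F V) :
    ∃! A : AffineConnection 𝕜 I F V, Intertwines P A.toConnection := by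
  -- Here the quotient map is the evaluation itself, so both comparison maps with `V` are the
  -- identity.
  obtain ⟨A, hA⟩ := P.exists_connection (hasLocalSections_frameEval 𝕜 I F V) (contMDiff_proj V)
    (fun _ => rfl) contMDiff_id contMDiff_id (fun _ => rfl) (fun _ => rfl)
  have h : Intertwines P A := fun ζ => tangentBundle_mk_eq rfl (hA ζ.1 ζ.2)
  refine ⟨⟨A, fun c v ξ => tangentBundle_snd_eq (h.map_smul c ⟨v, ξ⟩), fun w ζ ζ' h1 h2 =>
    tangentBundle_snd_eq (h.map_add (ζ := ⟨w, ζ⟩) (ζ' := ⟨w, ζ'⟩) (tangentBundle_mk_eq rfl h1)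
      (tangentBundle_mk_eq rfl h2))⟩, h, fun A' h' => AffineConnection.ext ?_⟩
  exact congrArg Connection.vert (h'.unique h)

/-- The connection induced by `P` is identified with `A` if and only if `A` intertwines the
evaluation map with `P`. -/
theorem IsInduced.isIdentified_iff {P : PrincipalConnection 𝕜 I F V}
    {B : Connection (I.prod 𝓘(ℝ, F)) I (assocProj 𝕜 F V)} (hB : IsInduced P B)
    (A : AffineConnection 𝕜 I F V) : IsIdentified B A ↔ Intertwines P A.toConnection := by
  have hq := hasLocalSections_assocMk 𝕜 I F V
  have hθ : ∀ (a : FrameBundle 𝕜 F V × F)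
      (ζ : TangentSpace ((I.prod 𝓘(ℝ, F →L[𝕜] F)).prod 𝓘(ℝ, F)) a),
      (mfderiv (I.prod 𝓘(ℝ, F)) (I.prod 𝓘(ℝ, F)) (assocHomeo 𝕜 F V) (assocMk a)
        (mfderiv ((I.prod 𝓘(ℝ, F →L[𝕜] F)).prod 𝓘(ℝ, F)) (I.prod 𝓘(ℝ, F)) assocMk a ζ) : E × F) =
      (mfderiv ((I.prod 𝓘(ℝ, F →L[𝕜] F)).prod 𝓘(ℝ, F)) (I.prod 𝓘(ℝ, F)) frameEval a ζ : E × F) :=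
    fun a ζ => mfderiv_mfderiv_eq rfl ((contMDiff_assocHomeo 𝕜 F V).mdifferentiableAt (by simp))
      (hq.smooth.mdifferentiableAt (by simp)) (Filter.Eventually.of_forall assocHomeo_mk) ζ
  -- The two relations agree on vectors `Tq ζ` because `Tθ ∘ Tq = T ev`, and every tangent vector of
  -- the associated bundle has this form.
  have key : ∀ (a : FrameBundle 𝕜 F V × F)
      (ζ : TangentSpace ((I.prod 𝓘(ℝ, F →L[𝕜] F)).prod 𝓘(ℝ, F)) a),
      (A.vert (assocHomeo 𝕜 F V (assocMk a))
        (mfderiv (I.prod 𝓘(ℝ, F)) (I.prod 𝓘(ℝ, F)) (assocHomeo 𝕜 F V) (assocMk a)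
        (mfderiv ((I.prod 𝓘(ℝ, F →L[𝕜] F)).prod 𝓘(ℝ, F)) (I.prod 𝓘(ℝ, F)) assocMk a ζ)) =
      mfderiv (I.prod 𝓘(ℝ, F)) (I.prod 𝓘(ℝ, F)) (assocHomeo 𝕜 F V) (assocMk a)
        (B.vert (assocMk a) (mfderiv ((I.prod 𝓘(ℝ, F →L[𝕜] F)).prod 𝓘(ℝ, F)) (I.prod 𝓘(ℝ, F))
          assocMk a ζ))) ↔
      A.vert (frameEval a)
        (mfderiv ((I.prod 𝓘(ℝ, F →L[𝕜] F)).prod 𝓘(ℝ, F)) (I.prod 𝓘(ℝ, F)) frameEval a ζ) =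
      mfderiv ((I.prod 𝓘(ℝ, F →L[𝕜] F)).prod 𝓘(ℝ, F)) (I.prod 𝓘(ℝ, F)) frameEval a
        (P.vertProd a ζ) := fun a ζ => by
    have e1 := congrArg (A.vert (frameEval a)) (hθ a ζ)
    have e2 := (congrArg (mfderiv (I.prod 𝓘(ℝ, F)) (I.prod 𝓘(ℝ, F)) (assocHomeo 𝕜 F V) (assocMk a))
      (hB a ζ.1 ζ.2)).trans (hθ a (P.vertProd a ζ))
    exact ⟨fun h => e1.symm.trans (h.trans e2), fun h => e1.trans (h.trans e2.symm)⟩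
  constructor
  · intro h ζ
    exact tangentBundle_mk_eq rfl ((key ζ.1 ζ.2).1 (h _ _))
  · intro h b ξ
    obtain ⟨a, rfl⟩ := hq.surjective b
    obtain ⟨ζ, rfl⟩ := hq.surjective_mfderiv a ξ
    exact (key a ζ).2 (tangentBundle_snd_eq (h ⟨a, ζ⟩))

/-! ### Coordinates of tangent vectors of `V` and of the frame bundle -/

theorem mfderiv_linear_comp {G G' : Type*} [NormedAddCommGroup G] [NormedSpace ℝ G]
    [NormedAddCommGroup G'] [NormedSpace ℝ G'] (L : G →L[ℝ] G') {f : X → G} {x : X}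
    (hf : MDifferentiableAt I' 𝓘(ℝ, G) f x) (ξ : TangentSpace I' x) :
    (mfderiv I' 𝓘(ℝ, G') (fun y => L (f y)) x ξ : G') = L (mfderiv I' 𝓘(ℝ, G) f x ξ : G) := by
  refine (mfderiv_mfderiv_eq rfl (L.contDiff (n := ∞) |>.contMDiff.mdifferentiableAt (by simp)) hf
    (Filter.Eventually.of_forall fun _ => rfl) ξ).symm.trans ?_
  rw [L.mfderiv_eq]
  rfl

/-- If `f₁` and `f₂` together have a differentiable left inverse, then their derivatives together
are injective. -/
theorem mfderiv_injective_pair {E₁ E₂ : Type*} [NormedAddCommGroup E₁] [NormedSpace ℝ E₁]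
    [NormedAddCommGroup E₂] [NormedSpace ℝ E₂] {H₁ H₂ : Type*} [TopologicalSpace H₁]
    [TopologicalSpace H₂] {I₁ : ModelWithCorners ℝ E₁ H₁} {I₂ : ModelWithCorners ℝ E₂ H₂}
    {Y : Type*} [TopologicalSpace Y] [ChartedSpace H₁ Y]
    {Z : Type*} [TopologicalSpace Z] [ChartedSpace H₂ Z]
    {f₁ : X → Y} {f₂ : X → Z} {S : Y × Z → X} {x : X}
    (h₁ : MDifferentiableAt I' I₁ f₁ x) (h₂ : MDifferentiableAt I' I₂ f₂ x)
    (hS : MDifferentiableAt (I₁.prod I₂) I' S (f₁ x, f₂ x))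
    (h : ∀ᶠ y in 𝓝 x, S (f₁ y, f₂ y) = y) {ξ η : TangentSpace I' x}
    (e₁ : mfderiv I' I₁ f₁ x ξ = mfderiv I' I₁ f₁ x η)
    (e₂ : mfderiv I' I₂ f₂ x ξ = mfderiv I' I₂ f₂ x η) : ξ = η := by
  have key := fun ξ => (mfderiv_mfderiv_eq (f := fun x => (f₁ x, f₂ x)) (h := fun x => x) rfl hS
    (h₁.prodMk h₂) h ξ).trans (mfderiv_id_of_eventually (by simp) ξ)
  rw [mfderiv_prodMk h₁ h₂] at key
  refine (key ξ).symm.trans (Eq.trans ?_ (key η))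
  exact congrArg (mfderiv (I₁.prod I₂) I' S (f₁ x, f₂ x)) (Prod.ext e₁ e₂)

/-- The derivative of the fibre coordinate of a local trivialization of `V`. -/
noncomputable def coordDeriv (I : ModelWithCorners ℝ E H) [IsManifold I ∞ M]
    [ContMDiffVectorBundle ∞ F V I] (e : Trivialization F (π F V))
    (ζ : TangentBundle (I.prod 𝓘(ℝ, F)) (TotalSpace F V)) : F :=
  mfderiv (I.prod 𝓘(ℝ, F)) 𝓘(ℝ, F) (fun v : TotalSpace F V => (e v).2) ζ.1 ζ.2

section coord
variable (e : Trivialization F (π F V)) [MemTrivializationAtlas e]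

theorem mdifferentiableAt_coord {v : TotalSpace F V} (hv : v.1 ∈ e.baseSet) :
    MDifferentiableAt (I.prod 𝓘(ℝ, F)) 𝓘(ℝ, F) (fun v : TotalSpace F V => (e v).2) v :=
  (contMDiffAt_coord e hv).mdifferentiableAt (by simp)

theorem coordDeriv_tangentMap {f : X → TotalSpace F V} {g : X → F} {ξ : TangentBundle I' X}
    (hf : MDifferentiableAt I' (I.prod 𝓘(ℝ, F)) f ξ.1) (he : (f ξ.1).1 ∈ e.baseSet)
    (h : ∀ᶠ x in 𝓝 ξ.1, (e (f x)).2 = g x) :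
    coordDeriv I e (tangentMap I' (I.prod 𝓘(ℝ, F)) f ξ) = mfderiv I' 𝓘(ℝ, F) g ξ.1 ξ.2 :=
  mfderiv_mfderiv_eq rfl (mdifferentiableAt_coord e he) hf h ξ.2

/-- The inverse of `e` is a differentiable left inverse of the projection paired with the fibre
coordinate. -/
theorem total_tangent_ext {v : TotalSpace F V} (hv : v.1 ∈ e.baseSet)
    {ξ η : TangentSpace (I.prod 𝓘(ℝ, F)) v}
    (h : mfderiv (I.prod 𝓘(ℝ, F)) I (TotalSpace.proj : TotalSpace F V → M) v ξ =
      mfderiv (I.prod 𝓘(ℝ, F)) I (TotalSpace.proj : TotalSpace F V → M) v η)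
    (h' : coordDeriv I e ⟨v, ξ⟩ = coordDeriv I e ⟨v, η⟩) : ξ = η := by
  have h1 : (v.1, (e v).2) ∈ e.target := e.mem_target.2 hv
  refine mfderiv_injective_pair (S := e.toOpenPartialHomeomorph.symm)
    ((contMDiff_proj V).mdifferentiableAt (n := ∞) (by simp)) (mdifferentiableAt_coord e hv)
    ((e.contMDiffOn_symm (n := ∞)).contMDiffAt (e.open_target.mem_nhds h1)
      |>.mdifferentiableAt (by simp)) ?_ h h'
  filter_upwards [(isOpen_total_preimage e.open_baseSet).mem_nhds hv] with w hw
  exact e.symm_apply_mk_proj (e.mem_source.2 hw)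

theorem mem_frameDomain {p : FrameBundle 𝕜 F V} (hp : frameProj p ∈ e.baseSet) :
    (frameProj p, frameCoord e p) ∈ frameDomain 𝕜 e :=
  ⟨hp, frameCoord_bijective e hp⟩

theorem mdifferentiableAt_frameOf {p : FrameBundle 𝕜 F V} (p₀ : FrameBundle 𝕜 F V)
    (hp : frameProj p ∈ e.baseSet) :
    MDifferentiableAt (I.prod 𝓘(ℝ, F →L[𝕜] F)) (I.prod 𝓘(ℝ, F →L[𝕜] F)) (frameOf p₀ e)
      (frameProj p, frameCoord e p) :=
  ((contMDiffOn_frameOf p₀ e).contMDiffAt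
    ((isOpen_frameDomain e).mem_nhds (mem_frameDomain e hp))).mdifferentiableAt (by simp)

theorem eventually_frameProj_mem {p : FrameBundle 𝕜 F V} (hp : frameProj p ∈ e.baseSet) :
    ∀ᶠ p' in 𝓝 p, frameProj p' ∈ e.baseSet :=
  ((FiberBundle.continuous_proj _ _).comp continuous_subtype_val).continuousAt
    (e.open_baseSet.mem_nhds hp)

theorem frame_tangent_ext {p : FrameBundle 𝕜 F V} (hp : frameProj p ∈ e.baseSet)
    {ξ η : TangentSpace (I.prod 𝓘(ℝ, F →L[𝕜] F)) p}
    (h : mfderiv (I.prod 𝓘(ℝ, F →L[𝕜] F)) I frameProj p ξ =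
      mfderiv (I.prod 𝓘(ℝ, F →L[𝕜] F)) I frameProj p η)
    (h' : mfderiv (I.prod 𝓘(ℝ, F →L[𝕜] F)) 𝓘(ℝ, F →L[𝕜] F) (frameCoord e) p ξ =
      mfderiv (I.prod 𝓘(ℝ, F →L[𝕜] F)) 𝓘(ℝ, F →L[𝕜] F) (frameCoord e) p η) : ξ = η := by
  refine mfderiv_injective_pair (S := frameOf p e)
    (contMDiff_frameProj.mdifferentiableAt (by simp))
    ((contMDiffAt_frameCoord e hp).mdifferentiableAt (by simp))
    (mdifferentiableAt_frameOf e p hp) ?_ h h'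
  filter_upwards [eventually_frameProj_mem e hp] with p' hp'
  exact frameOf_frameCoord p e hp'

/-- The vertical tangent vector with a given fibre coordinate. -/
theorem mfderiv_frameOf_vertical {p : FrameBundle 𝕜 F V} (p₀ : FrameBundle 𝕜 F V)
    (hp : frameProj p ∈ e.baseSet) (A : F →L[𝕜] F) :
    let ξ : TangentSpace (I.prod 𝓘(ℝ, F →L[𝕜] F)) p :=
      (mfderiv (I.prod 𝓘(ℝ, F →L[𝕜] F)) (I.prod 𝓘(ℝ, F →L[𝕜] F)) (frameOf p₀ e)
        (frameProj p, frameCoord e p) ((0 : E), A) : E × (F →L[𝕜] F))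
    mfderiv (I.prod 𝓘(ℝ, F →L[𝕜] F)) I frameProj p ξ = 0 ∧
      mfderiv (I.prod 𝓘(ℝ, F →L[𝕜] F)) 𝓘(ℝ, F →L[𝕜] F) (frameCoord e) p ξ = A := by
  intro ξ
  have hn := (isOpen_frameDomain e).mem_nhds (mem_frameDomain e hp)
  constructor
  · refine (mfderiv_mfderiv_eq (h := Prod.fst) (frameOf_frameCoord p₀ e hp)
      (contMDiff_frameProj.mdifferentiableAt (by simp)) (mdifferentiableAt_frameOf e p₀ hp)
      ?_ ((0 : E), A)).trans ?_
    · filter_upwards [hn] with b hb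
      exact frameProj_frameOf p₀ e hb.1 hb.2
    · rw [mfderiv_fst]; rfl
  · refine (mfderiv_mfderiv_eq (h := Prod.snd) (frameOf_frameCoord p₀ e hp)
      ((contMDiffAt_frameCoord e hp).mdifferentiableAt (by simp))
      (mdifferentiableAt_frameOf e p₀ hp) ?_ ((0 : E), A)).trans ?_
    · filter_upwards [hn] with b hb
      exact frameCoord_frameOf p₀ e hb.1 hb.2
    · rw [mfderiv_snd]; rfl

end coord

variable (𝕜 V) in
/-- Evaluation of frames at a vector. -/
def evalAt (u : F) (p : FrameBundle 𝕜 F V) : TotalSpace F V := frameEval (p, u)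

variable (𝕜 V I) in
theorem contMDiff_evalAt (u : F) :
    ContMDiff (I.prod 𝓘(ℝ, F →L[𝕜] F)) (I.prod 𝓘(ℝ, F)) ∞ (evalAt 𝕜 V u) :=
  contMDiff_frameEval.comp (contMDiff_id.prodMk contMDiff_const)

theorem mdifferentiableAt_evalAt (u : F) (p : FrameBundle 𝕜 F V) :
    MDifferentiableAt (I.prod 𝓘(ℝ, F →L[𝕜] F)) (I.prod 𝓘(ℝ, F)) (evalAt 𝕜 V u) p :=
  (contMDiff_evalAt 𝕜 I V u).mdifferentiableAt (by simp)

theorem mfderiv_proj_evalAt (u : F) (p : FrameBundle 𝕜 F V)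
    (ξ : TangentSpace (I.prod 𝓘(ℝ, F →L[𝕜] F)) p) :
    (mfderiv (I.prod 𝓘(ℝ, F)) I (TotalSpace.proj : TotalSpace F V → M) (evalAt 𝕜 V u p)
      (mfderiv (I.prod 𝓘(ℝ, F →L[𝕜] F)) (I.prod 𝓘(ℝ, F)) (evalAt 𝕜 V u) p ξ) : E) =
    (mfderiv (I.prod 𝓘(ℝ, F →L[𝕜] F)) I frameProj p ξ : E) :=
  mfderiv_mfderiv_eq rfl ((contMDiff_proj V).mdifferentiableAt (n := ∞) (by simp))
    (mdifferentiableAt_evalAt u p) (Filter.Eventually.of_forall fun _ => rfl) ξ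

/-- The derivative of the coordinate `frameCoord e`. -/
noncomputable def frameCoordDeriv (e : Trivialization F (π F V)) [MemTrivializationAtlas e]
    (p : FrameBundle 𝕜 F V) (ξ : TangentSpace (I.prod 𝓘(ℝ, F →L[𝕜] F)) p) : F →L[𝕜] F :=
  mfderiv (I.prod 𝓘(ℝ, F →L[𝕜] F)) 𝓘(ℝ, F →L[𝕜] F) (frameCoord e) p ξ

/-- In coordinates the evaluation at `u` is the real-linear map `B ↦ B u`, which commutes with
differentiation. -/
theorem coordDeriv_evalAt (e : Trivialization F (π F V)) [MemTrivializationAtlas e] (u : F)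
    {p : FrameBundle 𝕜 F V} (hp : frameProj p ∈ e.baseSet)
    (ξ : TangentSpace (I.prod 𝓘(ℝ, F →L[𝕜] F)) p) :
    coordDeriv I e (tangentMap (I.prod 𝓘(ℝ, F →L[𝕜] F)) (I.prod 𝓘(ℝ, F)) (evalAt 𝕜 V u) ⟨p, ξ⟩) =
      frameCoordDeriv e p ξ u := by
  have := homFinite 𝕜 F
  let T : (F →L[𝕜] F) →ₗ[ℝ] F :=
    { toFun := fun A => A u, map_add' := fun _ _ => rfl, map_smul' := fun _ _ => rfl }
  refine (coordDeriv_tangentMap e (g := fun p => LinearMap.toContinuousLinearMap T (frameCoord e p))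
    (mdifferentiableAt_evalAt u p) hp ?_).trans
    (mfderiv_linear_comp (LinearMap.toContinuousLinearMap T)
      ((contMDiffAt_frameCoord e hp).mdifferentiableAt (by simp)) ξ)
  filter_upwards [eventually_frameProj_mem e hp] with p' hp'
  exact (frameCoord_apply e hp' u).symm

/-- A tangent vector of the frame bundle is determined by its images under the evaluations. -/
theorem frame_tangent_ext_evalAt {p : FrameBundle 𝕜 F V}
    {ξ η : TangentSpace (I.prod 𝓘(ℝ, F →L[𝕜] F)) p}
    (h : ∀ u, mfderiv (I.prod 𝓘(ℝ, F →L[𝕜] F)) (I.prod 𝓘(ℝ, F)) (evalAt 𝕜 V u) p ξ =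
      mfderiv (I.prod 𝓘(ℝ, F →L[𝕜] F)) (I.prod 𝓘(ℝ, F)) (evalAt 𝕜 V u) p η) : ξ = η := by
  let e := trivializationAt F V (frameProj p)
  have he : frameProj p ∈ e.baseSet := mem_baseSet_trivializationAt F V _
  refine frame_tangent_ext e he ?_ ?_
  -- Any vector would do in place of `0`: all evaluations cover the identity of `M`.
  · refine (mfderiv_proj_evalAt 0 p ξ).symm.trans (Eq.trans ?_ (mfderiv_proj_evalAt 0 p η))
    rw [h]
  · refine ContinuousLinearMap.ext fun u => ?_
    refine (coordDeriv_evalAt e u he ξ).symm.trans (Eq.trans ?_ (coordDeriv_evalAt e u he η))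
    exact congrArg (coordDeriv I e) (tangentBundle_mk_eq rfl (h u))

section coord
variable (e : Trivialization F (π F V)) [MemTrivializationAtlas e]

theorem coordDeriv_fibreSMul (c : 𝕜) {ζ : TangentBundle (I.prod 𝓘(ℝ, F)) (TotalSpace F V)}
    (hζ : ζ.1.1 ∈ e.baseSet) :
    coordDeriv I e (tangentMap (I.prod 𝓘(ℝ, F)) (I.prod 𝓘(ℝ, F)) (fibreSMul 𝕜 F V c) ζ) =
      c • coordDeriv I e ζ := by
  let L : F →L[ℝ] F := (c • ContinuousLinearMap.id 𝕜 F).restrictScalars ℝ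
  refine (coordDeriv_tangentMap e (g := fun v => L (e v).2)
    ((contMDiff_fibreSMul c).mdifferentiableAt (by simp)) hζ ?_).trans
    (mfderiv_linear_comp L (mdifferentiableAt_coord e hζ) ζ.2)
  filter_upwards [(isOpen_total_preimage e.open_baseSet).mem_nhds hζ] with w hw
  exact (Trivialization.linear 𝕜 e hw).map_smul c w.2

theorem coordDeriv_fibreAdd {ζ : TangentBundle (I.prod 𝓘(ℝ, F × F)) (TotalSpace (F × F) (V ×ᵇ V))}
    (hζ : ζ.1.1 ∈ e.baseSet) :
    coordDeriv I e (tangentMap (I.prod 𝓘(ℝ, F × F)) (I.prod 𝓘(ℝ, F)) (fibreAdd F V) ζ) =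
      coordDeriv I e (tangentMap (I.prod 𝓘(ℝ, F × F)) (I.prod 𝓘(ℝ, F)) (fibreFst F V) ζ) +
      coordDeriv I e (tangentMap (I.prod 𝓘(ℝ, F × F)) (I.prod 𝓘(ℝ, F)) (fibreSnd F V) ζ) := by
  have h1 : MDifferentiableAt (I.prod 𝓘(ℝ, F × F)) 𝓘(ℝ, F)
      (fun w => (e (fibreFst F V w)).2) ζ.1 :=
    (mdifferentiableAt_coord (I := I) (v := fibreFst F V ζ.1) e hζ).comp ζ.1
      (contMDiff_fibreFst.mdifferentiableAt (by simp))
  have h2 : MDifferentiableAt (I.prod 𝓘(ℝ, F × F)) 𝓘(ℝ, F)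
      (fun w => (e (fibreSnd F V w)).2) ζ.1 :=
    (mdifferentiableAt_coord (I := I) (v := fibreSnd F V ζ.1) e hζ).comp ζ.1
      (contMDiff_fibreSnd.mdifferentiableAt (by simp))
  rw [coordDeriv_tangentMap e (f := fibreFst F V)
      (contMDiff_fibreFst.mdifferentiableAt (by simp)) hζ
      (Filter.Eventually.of_forall fun _ => rfl),
    coordDeriv_tangentMap e (f := fibreSnd F V)
      (contMDiff_fibreSnd.mdifferentiableAt (by simp)) hζ
      (Filter.Eventually.of_forall fun _ => rfl)]
  refine (coordDeriv_tangentMap e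
    (g := (fun w => (e (fibreFst F V w)).2) + fun w => (e (fibreSnd F V w)).2)
    (contMDiff_fibreAdd.mdifferentiableAt (by simp)) hζ ?_).trans ?_
  · filter_upwards [(e.open_baseSet.preimage
      (FiberBundle.continuous_proj (F × F) (V ×ᵇ V))).mem_nhds hζ] with w hw
    exact (Trivialization.linear ℝ e hw).map_add w.2.1 w.2.2
  · rw [mfderiv_add h1 h2]
    rfl

end coord

/-- Every vertical tangent vector of `V` is tangent to the fibre. -/
theorem exists_vertical (p : FrameBundle 𝕜 F V) (u : F)
    {ζ : TangentSpace (I.prod 𝓘(ℝ, F)) (frameEval (p, u))}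
    (h : mfderiv (I.prod 𝓘(ℝ, F)) I (TotalSpace.proj : TotalSpace F V → M)
      (frameEval (p, u)) ζ = 0) :
    ∃ x : F, (mfderiv 𝓘(ℝ, F) (I.prod 𝓘(ℝ, F)) (fun y => frameEval (p, y)) u x : E × F) = ζ := by
  let e := trivializationAt F V (frameProj p)
  have he : frameProj p ∈ e.baseSet := mem_baseSet_trivializationAt F V _
  -- In coordinates the derivative of `y ↦ p y` is the frame coordinate of `p`, so `x` is the
  -- preimage of the fibre coordinate of `ζ`.
  obtain ⟨x, hx⟩ := (frameCoord_bijective e he).surjective (coordDeriv I e ⟨_, ζ⟩)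
  have hd : MDifferentiableAt 𝓘(ℝ, F) (I.prod 𝓘(ℝ, F)) (fun y => frameEval (p, y)) u :=
    ((contMDiff_frameEval (I := I)).comp (contMDiff_const.prodMk contMDiff_id)).mdifferentiableAt
      (by simp)
  refine ⟨x, total_tangent_ext e (v := frameEval (p, u)) he ?_ ?_⟩
  · rw [h]
    refine (mfderiv_mfderiv_eq (h := fun _ => frameProj p) rfl
      ((contMDiff_proj V).mdifferentiableAt (n := ∞) (by simp)) hd
      (Filter.Eventually.of_forall fun _ => rfl) x).trans ?_
    rw [mfderiv_const]
    rfl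
  · rw [← hx]
    have h1 := coordDeriv_tangentMap e (ξ := (⟨u, x⟩ : TangentBundle 𝓘(ℝ, F) F))
      (g := (frameCoord e p).restrictScalars ℝ) hd he
      (Filter.Eventually.of_forall fun y => (frameCoord_apply e he y).symm)
    rw [ContinuousLinearMap.mfderiv_eq] at h1
    exact h1

/-! ### From an affine to a principal connection: the pointwise construction -/

namespace AffineConnection

variable (A : AffineConnection 𝕜 I F V)

theorem total_fibreSMul (c : 𝕜) (ζ : TangentBundle (I.prod 𝓘(ℝ, F)) (TotalSpace F V)) :
    A.total (tangentMap (I.prod 𝓘(ℝ, F)) (I.prod 𝓘(ℝ, F)) (fibreSMul 𝕜 F V c) ζ) =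
      tangentMap (I.prod 𝓘(ℝ, F)) (I.prod 𝓘(ℝ, F)) (fibreSMul 𝕜 F V c) (A.total ζ) :=
  tangentBundle_mk_eq rfl (A.map_smul c ζ.1 ζ.2)

/-- The fibre coordinate of the vertical part of the image of a vector under an evaluation. -/
noncomputable def evalCoord (e : Trivialization F (π F V))
    (ξ : TangentBundle (I.prod 𝓘(ℝ, F →L[𝕜] F)) (FrameBundle 𝕜 F V)) (u : F) : F :=
  coordDeriv I e
    (A.total (tangentMap (I.prod 𝓘(ℝ, F →L[𝕜] F)) (I.prod 𝓘(ℝ, F)) (evalAt 𝕜 V u) ξ))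

theorem evalCoord_smul (e : Trivialization F (π F V)) [MemTrivializationAtlas e]
    {ξ : TangentBundle (I.prod 𝓘(ℝ, F →L[𝕜] F)) (FrameBundle 𝕜 F V)}
    (hξ : frameProj ξ.1 ∈ e.baseSet) (c : 𝕜) (u : F) :
    A.evalCoord e ξ (c • u) = c • A.evalCoord e ξ u := by
  have h : evalAt 𝕜 V (c • u) = fibreSMul 𝕜 F V c ∘ evalAt 𝕜 V u := funext fun p => by
    change (⟨frameProj p, frameMap p (c • u)⟩ : TotalSpace F V) =
      ⟨frameProj p, c • frameMap p u⟩
    rw [_root_.map_smul]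
  rw [evalCoord, h, tangentMap_comp_at _ ((contMDiff_fibreSMul c).mdifferentiableAt (by simp))
    (mdifferentiableAt_evalAt u ξ.1), total_fibreSMul]
  exact coordDeriv_fibreSMul e c (ζ := A.total (tangentMap (I.prod 𝓘(ℝ, F →L[𝕜] F))
    (I.prod 𝓘(ℝ, F)) (evalAt 𝕜 V u) ξ)) hξ

/-- Additivity of `A` is stated for a vector `ζ'` of `T(V ×_M V)` whose components are the vertical
parts of those of `ζ`, so such a `ζ'` must be produced. Both vertical parts are tangent to the
fibre, hence come from directions `x` and `x'` in `F`, and `(x, x')` pushed forward by `(z, z') ↦ (p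
z, p z')` is the required vector. -/
theorem evalCoord_add (e : Trivialization F (π F V)) [MemTrivializationAtlas e]
    {ξ : TangentBundle (I.prod 𝓘(ℝ, F →L[𝕜] F)) (FrameBundle 𝕜 F V)}
    (hξ : frameProj ξ.1 ∈ e.baseSet) (u u' : F) :
    A.evalCoord e ξ (u + u') = A.evalCoord e ξ u + A.evalCoord e ξ u' := by
  obtain ⟨p, ξ⟩ := ξ
  let f : FrameBundle 𝕜 F V → TotalSpace (F × F) (V ×ᵇ V) := fun p => frameEvalPair (p, u, u')
  have hf : ContMDiff (I.prod 𝓘(ℝ, F →L[𝕜] F)) (I.prod 𝓘(ℝ, F × F)) ∞ f :=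
    (contMDiff_frameEvalPair 𝕜 I F V).comp (contMDiff_id.prodMk contMDiff_const)
  let g : F × F → TotalSpace (F × F) (V ×ᵇ V) := fun z => frameEvalPair (p, z)
  have hg : MDifferentiableAt 𝓘(ℝ, F × F) (I.prod 𝓘(ℝ, F × F)) g (u, u') :=
    ((contMDiff_frameEvalPair 𝕜 I F V).comp
      (contMDiff_const.prodMk contMDiff_id)).mdifferentiableAt (by simp)
  obtain ⟨x, hx⟩ := exists_vertical p u (A.mfderiv_proj_vert (frameEval (p, u))
    (mfderiv (I.prod 𝓘(ℝ, F →L[𝕜] F)) (I.prod 𝓘(ℝ, F)) (evalAt 𝕜 V u) p ξ))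
  obtain ⟨x', hx'⟩ := exists_vertical p u' (A.mfderiv_proj_vert (frameEval (p, u'))
    (mfderiv (I.prod 𝓘(ℝ, F →L[𝕜] F)) (I.prod 𝓘(ℝ, F)) (evalAt 𝕜 V u') p ξ))
  have hd : ∀ u : F, MDifferentiableAt 𝓘(ℝ, F) (I.prod 𝓘(ℝ, F)) (fun y => frameEval (p, y)) u :=
    ((contMDiff_frameEval (I := I)).comp (contMDiff_const.prodMk contMDiff_id)).mdifferentiable
      (by simp)
  let ζ : TangentSpace (I.prod 𝓘(ℝ, F × F)) (f p) :=
    mfderiv (I.prod 𝓘(ℝ, F →L[𝕜] F)) (I.prod 𝓘(ℝ, F × F)) f p ξ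
  let ζ' : TangentSpace (I.prod 𝓘(ℝ, F × F)) (f p) :=
    mfderiv 𝓘(ℝ, F × F) (I.prod 𝓘(ℝ, F × F)) g (u, u') (x, x')
  have hf1 : (mfderiv (I.prod 𝓘(ℝ, F × F)) (I.prod 𝓘(ℝ, F)) (fibreFst F V) (f p) ζ : E × F) =
      mfderiv (I.prod 𝓘(ℝ, F →L[𝕜] F)) (I.prod 𝓘(ℝ, F)) (evalAt 𝕜 V u) p ξ :=
    mfderiv_mfderiv_eq rfl (contMDiff_fibreFst.mdifferentiableAt (by simp))
      (hf.mdifferentiableAt (by simp)) (Filter.Eventually.of_forall fun _ => rfl) ξ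
  have hf2 : (mfderiv (I.prod 𝓘(ℝ, F × F)) (I.prod 𝓘(ℝ, F)) (fibreSnd F V) (f p) ζ : E × F) =
      mfderiv (I.prod 𝓘(ℝ, F →L[𝕜] F)) (I.prod 𝓘(ℝ, F)) (evalAt 𝕜 V u') p ξ :=
    mfderiv_mfderiv_eq rfl (contMDiff_fibreSnd.mdifferentiableAt (by simp))
      (hf.mdifferentiableAt (by simp)) (Filter.Eventually.of_forall fun _ => rfl) ξ
  have hg1 : (mfderiv (I.prod 𝓘(ℝ, F × F)) (I.prod 𝓘(ℝ, F)) (fibreFst F V) (f p) ζ' : E × F) =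
      mfderiv 𝓘(ℝ, F) (I.prod 𝓘(ℝ, F)) (fun y => frameEval (p, y)) u x := by
    refine (mfderiv_mfderiv_eq rfl (contMDiff_fibreFst.mdifferentiableAt (by simp)) hg
      (Filter.Eventually.of_forall fun _ => rfl) (x, x')).trans ?_
    refine (mfderiv_mfderiv_eq rfl (hd u)
      ((ContinuousLinearMap.fst ℝ F F).mdifferentiableAt (x := (u, u')))
      (Filter.Eventually.of_forall fun _ => rfl) (x, x')).symm.trans ?_
    rw [ContinuousLinearMap.mfderiv_eq]
    rfl
  have hg2 : (mfderiv (I.prod 𝓘(ℝ, F × F)) (I.prod 𝓘(ℝ, F)) (fibreSnd F V) (f p) ζ' : E × F) =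
      mfderiv 𝓘(ℝ, F) (I.prod 𝓘(ℝ, F)) (fun y => frameEval (p, y)) u' x' := by
    refine (mfderiv_mfderiv_eq rfl (contMDiff_fibreSnd.mdifferentiableAt (by simp)) hg
      (Filter.Eventually.of_forall fun _ => rfl) (x, x')).trans ?_
    refine (mfderiv_mfderiv_eq rfl (hd u')
      ((ContinuousLinearMap.snd ℝ F F).mdifferentiableAt (x := (u, u')))
      (Filter.Eventually.of_forall fun _ => rfl) (x, x')).symm.trans ?_
    rw [ContinuousLinearMap.mfderiv_eq]
    rfl
  have h1 := (hg1.trans hx).trans (congrArg (A.vert (frameEval (p, u))) hf1).symm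
  have h2 := (hg2.trans hx').trans (congrArg (A.vert (frameEval (p, u'))) hf2).symm
  have key := A.map_add (f p) ζ ζ' h1 h2
  have hsum : evalAt 𝕜 V (u + u') = fibreAdd F V ∘ f := funext fun p => by
    change (⟨frameProj p, frameMap p (u + u')⟩ : TotalSpace F V) =
      ⟨frameProj p, frameMap p u + frameMap p u'⟩
    rw [_root_.map_add]
  have key' : A.total (tangentMap (I.prod 𝓘(ℝ, F →L[𝕜] F)) (I.prod 𝓘(ℝ, F))
      (evalAt 𝕜 V (u + u')) ⟨p, ξ⟩) =
      tangentMap (I.prod 𝓘(ℝ, F × F)) (I.prod 𝓘(ℝ, F)) (fibreAdd F V) ⟨f p, ζ'⟩ := by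
    rw [hsum, tangentMap_comp_at _ (contMDiff_fibreAdd.mdifferentiableAt (by simp))
      (hf.mdifferentiableAt (by simp))]
    exact tangentBundle_mk_eq rfl key
  rw [evalCoord, key', coordDeriv_fibreAdd e hξ]
  refine congrArg₂ (· + ·) (congrArg _ ?_) (congrArg _ ?_)
  · exact tangentBundle_mk_eq rfl (hg1.trans hx)
  · exact tangentBundle_mk_eq rfl (hg2.trans hx')

/-- The vertical projection of the principal connection exists at every point. -/
theorem exists_vert (p : FrameBundle 𝕜 F V) (ξ : TangentSpace (I.prod 𝓘(ℝ, F →L[𝕜] F)) p) :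
    ∃ η : TangentSpace (I.prod 𝓘(ℝ, F →L[𝕜] F)) p, ∀ u,
      mfderiv (I.prod 𝓘(ℝ, F →L[𝕜] F)) (I.prod 𝓘(ℝ, F)) (evalAt 𝕜 V u) p η =
      A.vert (evalAt 𝕜 V u p)
        (mfderiv (I.prod 𝓘(ℝ, F →L[𝕜] F)) (I.prod 𝓘(ℝ, F)) (evalAt 𝕜 V u) p ξ) := by
  have : FiniteDimensional 𝕜 F := Module.Finite.of_restrictScalars_finite ℝ 𝕜 F
  let e := trivializationAt F V (frameProj p)
  have he : frameProj p ∈ e.baseSet := mem_baseSet_trivializationAt F V _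
  -- Vertical vectors of the frame bundle correspond to endomorphisms of `F`. The coordinates
  -- demanded by `A` form one, because they are `𝕜`-linear in `u`.
  let T : F →ₗ[𝕜] F :=
    { toFun := A.evalCoord e ⟨p, ξ⟩
      map_add' := A.evalCoord_add e he
      map_smul' := A.evalCoord_smul e he }
  obtain ⟨η, h1, h2⟩ : ∃ η : TangentSpace (I.prod 𝓘(ℝ, F →L[𝕜] F)) p,
      mfderiv (I.prod 𝓘(ℝ, F →L[𝕜] F)) I frameProj p η = 0 ∧
      frameCoordDeriv e p η = LinearMap.toContinuousLinearMap T :=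
    ⟨_, mfderiv_frameOf_vertical (I := I) e p he (LinearMap.toContinuousLinearMap T)⟩
  refine ⟨η, fun u => total_tangent_ext (v := evalAt 𝕜 V u p) e he ?_ ?_⟩
  · rw [A.mfderiv_proj_vert]
    exact (mfderiv_proj_evalAt u p _).trans h1
  · exact (coordDeriv_evalAt e u he _).trans (congrArg (fun B : F →L[𝕜] F => B u) h2)

end AffineConnection

/-! ### From an affine to a principal connection: linearity, smoothness, equivariance -/

variable [FiniteDimensional ℝ E]

namespace AffineConnection

variable (A : AffineConnection 𝕜 I F V)

/-- The vector supplied by `exists_vert` is unique, so it depends linearly on `ξ`; continuity is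
automatic in finite dimension. -/
theorem exists_vert_linear (p : FrameBundle 𝕜 F V) :
    ∃ P : TangentSpace (I.prod 𝓘(ℝ, F →L[𝕜] F)) p →L[ℝ] TangentSpace (I.prod 𝓘(ℝ, F →L[𝕜] F)) p,
      ∀ ξ u, mfderiv (I.prod 𝓘(ℝ, F →L[𝕜] F)) (I.prod 𝓘(ℝ, F)) (evalAt 𝕜 V u) p (P ξ) =
      A.vert (evalAt 𝕜 V u p)
        (mfderiv (I.prod 𝓘(ℝ, F →L[𝕜] F)) (I.prod 𝓘(ℝ, F)) (evalAt 𝕜 V u) p ξ) := by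
  choose f hf using A.exists_vert p
  have := homFinite 𝕜 F
  have : FiniteDimensional ℝ (TangentSpace (I.prod 𝓘(ℝ, F →L[𝕜] F)) p) :=
    inferInstanceAs (FiniteDimensional ℝ (E × (F →L[𝕜] F)))
  have : T2Space (TangentSpace (I.prod 𝓘(ℝ, F →L[𝕜] F)) p) :=
    inferInstanceAs (T2Space (E × (F →L[𝕜] F)))
  let L : TangentSpace (I.prod 𝓘(ℝ, F →L[𝕜] F)) p →ₗ[ℝ]
      TangentSpace (I.prod 𝓘(ℝ, F →L[𝕜] F)) p :=
    { toFun := f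
      map_add' := fun ξ η => frame_tangent_ext_evalAt fun u => by
        rw [hf, _root_.map_add, _root_.map_add, _root_.map_add, hf, hf]
      map_smul' := fun c ξ => frame_tangent_ext_evalAt fun u => by
        rw [hf, _root_.map_smul, _root_.map_smul, RingHom.id_apply, _root_.map_smul, hf] }
  exact ⟨LinearMap.toContinuousLinearMap L, hf⟩

/-- The vertical projection of the principal connection corresponding to `A`. -/
noncomputable def principalVert (p : FrameBundle 𝕜 F V) :
    TangentSpace (I.prod 𝓘(ℝ, F →L[𝕜] F)) p →L[ℝ] TangentSpace (I.prod 𝓘(ℝ, F →L[𝕜] F)) p :=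
  (A.exists_vert_linear p).choose

theorem mfderiv_evalAt_principalVert (p : FrameBundle 𝕜 F V)
    (ξ : TangentSpace (I.prod 𝓘(ℝ, F →L[𝕜] F)) p) (u : F) :
    mfderiv (I.prod 𝓘(ℝ, F →L[𝕜] F)) (I.prod 𝓘(ℝ, F)) (evalAt 𝕜 V u) p (A.principalVert p ξ) =
      A.vert (evalAt 𝕜 V u p)
        (mfderiv (I.prod 𝓘(ℝ, F →L[𝕜] F)) (I.prod 𝓘(ℝ, F)) (evalAt 𝕜 V u) p ξ) :=
  (A.exists_vert_linear p).choose_spec ξ u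

theorem mfderiv_frameProj_principalVert (p : FrameBundle 𝕜 F V)
    (ξ : TangentSpace (I.prod 𝓘(ℝ, F →L[𝕜] F)) p) :
    mfderiv (I.prod 𝓘(ℝ, F →L[𝕜] F)) I frameProj p (A.principalVert p ξ) = 0 := by
  refine (mfderiv_proj_evalAt 0 p _).symm.trans ?_
  rw [mfderiv_evalAt_principalVert]
  exact A.mfderiv_proj_vert _ _

theorem principalVert_eq_self {p : FrameBundle 𝕜 F V}
    {ξ : TangentSpace (I.prod 𝓘(ℝ, F →L[𝕜] F)) p}
    (h : mfderiv (I.prod 𝓘(ℝ, F →L[𝕜] F)) I frameProj p ξ = 0) : A.principalVert p ξ = ξ :=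
  frame_tangent_ext_evalAt fun u => by
    rw [mfderiv_evalAt_principalVert]
    exact A.vert_eq_self ((mfderiv_proj_evalAt u p ξ).trans h)

theorem frameCoordDeriv_principalVert (e : Trivialization F (π F V)) [MemTrivializationAtlas e]
    {p : FrameBundle 𝕜 F V} (hp : frameProj p ∈ e.baseSet)
    (ξ : TangentSpace (I.prod 𝓘(ℝ, F →L[𝕜] F)) p) (u : F) :
    frameCoordDeriv e p (A.principalVert p ξ) u = A.evalCoord e ⟨p, ξ⟩ u :=
  (coordDeriv_evalAt e u hp _).symm.trans (congrArg (coordDeriv I e)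
    (tangentBundle_mk_eq rfl (A.mfderiv_evalAt_principalVert p ξ u)))

/-- A composition of smooth maps: `T ev_u`, then `A`, then the tangent map of the fibre coordinate,
then the projection of `TF = F × F` to the vector part. -/
theorem contMDiffAt_evalCoord (e : Trivialization F (π F V)) [MemTrivializationAtlas e]
    {ξ : TangentBundle (I.prod 𝓘(ℝ, F →L[𝕜] F)) (FrameBundle 𝕜 F V)}
    (hξ : frameProj ξ.1 ∈ e.baseSet) (u : F) :
    ContMDiffAt (I.prod 𝓘(ℝ, F →L[𝕜] F)).tangent 𝓘(ℝ, F) ∞ (fun ξ => A.evalCoord e ξ u) ξ := by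
  have hφ : ContMDiffOn (I.prod 𝓘(ℝ, F)) 𝓘(ℝ, F) ∞ (fun v : TotalSpace F V => (e v).2)
      {v | v.1 ∈ e.baseSet} := fun v hv => (contMDiffAt_coord e hv).contMDiffWithinAt
  have h1 := contMDiffAt_tangentMap hφ (isOpen_total_preimage e.open_baseSet)
    (ξ := A.total (tangentMap (I.prod 𝓘(ℝ, F →L[𝕜] F)) (I.prod 𝓘(ℝ, F)) (evalAt 𝕜 V u) ξ)) hξ
  have h2 := ((contMDiff_evalAt 𝕜 I V u).contMDiff_tangentMap (m := ∞) le_rfl).contMDiffAt (x := ξ)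
  have h3 : ContMDiffAt (I.prod 𝓘(ℝ, F →L[𝕜] F)).tangent (I.prod 𝓘(ℝ, F)).tangent ∞
      (fun ξ => A.total (tangentMap (I.prod 𝓘(ℝ, F →L[𝕜] F)) (I.prod 𝓘(ℝ, F))
        (evalAt 𝕜 V u) ξ)) ξ :=
    ContMDiffAt.comp (g := A.total) ξ A.smooth.contMDiffAt h2
  exact (contMDiff_snd_tangentBundle_vectorSpace (E₁ := F)).contMDiffAt.comp ξ (h1.comp ξ h3)

/-- Near `ξ₀` the vertical part of `ξ` is `T(frameOf)` applied to `(0, X ξ)`, where the endomorphism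
`X ξ` is smooth because each `X ξ u` is an `evalCoord`. -/
theorem smooth_principalVert :
    ContMDiff (I.prod 𝓘(ℝ, F →L[𝕜] F)).tangent (I.prod 𝓘(ℝ, F →L[𝕜] F)).tangent ∞
      (fun ξ : TangentBundle (I.prod 𝓘(ℝ, F →L[𝕜] F)) (FrameBundle 𝕜 F V) =>
        (⟨ξ.1, A.principalVert ξ.1 ξ.2⟩ :
          TangentBundle (I.prod 𝓘(ℝ, F →L[𝕜] F)) (FrameBundle 𝕜 F V))) := by
  intro ξ₀
  let e := trivializationAt F V (frameProj ξ₀.1)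
  have he : frameProj ξ₀.1 ∈ e.baseSet := mem_baseSet_trivializationAt F V _
  have hproj : ContMDiff (I.prod 𝓘(ℝ, F →L[𝕜] F)).tangent (I.prod 𝓘(ℝ, F →L[𝕜] F)) ∞
      (TotalSpace.proj : TangentBundle (I.prod 𝓘(ℝ, F →L[𝕜] F)) (FrameBundle 𝕜 F V) → _) :=
    contMDiff_proj _
  have hn : ∀ᶠ ξ : TangentBundle (I.prod 𝓘(ℝ, F →L[𝕜] F)) (FrameBundle 𝕜 F V) in 𝓝 ξ₀,
      frameProj ξ.1 ∈ e.baseSet :=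
    hproj.continuous.continuousAt (eventually_frameProj_mem e he)
  let X : TangentBundle (I.prod 𝓘(ℝ, F →L[𝕜] F)) (FrameBundle 𝕜 F V) → F →L[𝕜] F := fun ξ =>
    frameCoordDeriv e ξ.1 (A.principalVert ξ.1 ξ.2)
  have hX : ContMDiffAt (I.prod 𝓘(ℝ, F →L[𝕜] F)).tangent 𝓘(ℝ, F →L[𝕜] F) ∞ X ξ₀ := by
    refine contMDiffAt_clm_of_apply fun u =>
      (A.contMDiffAt_evalCoord e he u).congr_of_eventuallyEq ?_
    filter_upwards [hn] with ξ hξ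
    exact A.frameCoordDeriv_principalVert e hξ ξ.2 u
  -- The component along `M` is the zero section, since the vector to be rebuilt is vertical.
  have h1 : ContMDiffAt (I.prod 𝓘(ℝ, F →L[𝕜] F)).tangent I.tangent ∞
      (fun ξ : TangentBundle (I.prod 𝓘(ℝ, F →L[𝕜] F)) (FrameBundle 𝕜 F V) =>
        (zeroSection E (TangentSpace I : M → Type _) (frameProj ξ.1) : TangentBundle I M)) ξ₀ :=
    ((contMDiff_zeroSection ℝ (TangentSpace I : M → Type _)).comp
      (contMDiff_frameProj.comp hproj)).contMDiffAt
  have h2 : ContMDiffAt (I.prod 𝓘(ℝ, F →L[𝕜] F)).tangent 𝓘(ℝ, F →L[𝕜] F).tangent ∞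
      (fun ξ : TangentBundle (I.prod 𝓘(ℝ, F →L[𝕜] F)) (FrameBundle 𝕜 F V) =>
        (⟨frameCoord e ξ.1, X ξ⟩ : TangentBundle 𝓘(ℝ, F →L[𝕜] F) (F →L[𝕜] F))) ξ₀ := by
    refine contMDiffAt_totalSpace.2 ⟨(contMDiffAt_frameCoord e he).comp ξ₀ hproj.contMDiffAt, ?_⟩
    refine hX.congr_of_eventuallyEq (Filter.Eventually.of_forall fun ξ => ?_)
    simp
  have h3 := (contMDiff_equivTangentBundleProd_symm (n := ∞) (I := I) (M := M)
    (I' := 𝓘(ℝ, F →L[𝕜] F)) (M' := F →L[𝕜] F)).contMDiffAt.comp ξ₀ (h1.prodMk h2)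
  have h4 := contMDiffAt_tangentMap (contMDiffOn_frameOf (I := I) ξ₀.1 e)
    (isOpen_frameDomain (𝕜 := 𝕜) e)
    (ξ := (⟨(frameProj ξ₀.1, frameCoord e ξ₀.1), ((0 : E), X ξ₀)⟩ :
      TangentBundle (I.prod 𝓘(ℝ, F →L[𝕜] F)) (M × (F →L[𝕜] F)))) (mem_frameDomain e he)
  refine (ContMDiffAt.comp ξ₀ h4 h3).congr_of_eventuallyEq ?_
  filter_upwards [hn] with ξ hξ
  obtain ⟨k1, k2⟩ := mfderiv_frameOf_vertical (I := I) e ξ₀.1 hξ (X ξ)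
  refine tangentBundle_mk_eq (frameOf_frameCoord ξ₀.1 e hξ).symm ?_
  exact frame_tangent_ext e hξ ((A.mfderiv_frameProj_principalVert _ _).trans k1.symm) k2.symm

/-- Both sides have the same image under every `T ev_u`, because `ev_u ∘ ρ_g = ev_{g u}`. -/
theorem principalVert_frameAct (g : F ≃L[𝕜] F) (p : FrameBundle 𝕜 F V)
    (ξ : TangentSpace (I.prod 𝓘(ℝ, F →L[𝕜] F)) p) :
    A.principalVert (frameAct g p)
        (mfderiv (I.prod 𝓘(ℝ, F →L[𝕜] F)) (I.prod 𝓘(ℝ, F →L[𝕜] F)) (frameAct g) p ξ) =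
      mfderiv (I.prod 𝓘(ℝ, F →L[𝕜] F)) (I.prod 𝓘(ℝ, F →L[𝕜] F)) (frameAct g) p
        (A.principalVert p ξ) := by
  have h : ∀ (u : F) (ξ : TangentSpace (I.prod 𝓘(ℝ, F →L[𝕜] F)) p),
      (mfderiv (I.prod 𝓘(ℝ, F →L[𝕜] F)) (I.prod 𝓘(ℝ, F)) (evalAt 𝕜 V u) (frameAct g p)
        (mfderiv (I.prod 𝓘(ℝ, F →L[𝕜] F)) (I.prod 𝓘(ℝ, F →L[𝕜] F)) (frameAct g) p ξ) : E × F) =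
      mfderiv (I.prod 𝓘(ℝ, F →L[𝕜] F)) (I.prod 𝓘(ℝ, F)) (evalAt 𝕜 V (g u)) p ξ := fun u ξ =>
    mfderiv_mfderiv_eq rfl (mdifferentiableAt_evalAt u _)
      ((contMDiff_frameAct g).mdifferentiableAt (by simp))
      (Filter.Eventually.of_forall fun _ => rfl) ξ
  refine frame_tangent_ext_evalAt fun u => ?_
  rw [mfderiv_evalAt_principalVert]
  refine (congrArg (A.vert (evalAt 𝕜 V (g u) p)) (h u ξ)).trans ?_
  exact (A.mfderiv_evalAt_principalVert p ξ (g u)).symm.trans (h u _).symm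

/-- The principal connection corresponding to an affine connection. -/
noncomputable def toPrincipal : PrincipalConnection 𝕜 I F V where
  vert := A.principalVert
  idempotent p ξ := A.principalVert_eq_self (A.mfderiv_frameProj_principalVert p ξ)
  range_vert p := by
    ext ξ
    refine ⟨?_, fun h => ⟨ξ, A.principalVert_eq_self h⟩⟩
    rintro ⟨η, rfl⟩
    exact A.mfderiv_frameProj_principalVert p η
  smooth := A.smooth_principalVert
  equivariant := A.principalVert_frameAct

end AffineConnection

theorem mfderiv_frameEval_apply (a : FrameBundle 𝕜 F V × F)
    (ζ : TangentSpace ((I.prod 𝓘(ℝ, F →L[𝕜] F)).prod 𝓘(ℝ, F)) a) :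
    mfderiv ((I.prod 𝓘(ℝ, F →L[𝕜] F)).prod 𝓘(ℝ, F)) (I.prod 𝓘(ℝ, F)) frameEval a ζ =
      mfderiv (I.prod 𝓘(ℝ, F →L[𝕜] F)) (I.prod 𝓘(ℝ, F)) (evalAt 𝕜 V a.2) a.1 ζ.1 +
        mfderiv 𝓘(ℝ, F) (I.prod 𝓘(ℝ, F)) (fun u => evalAt 𝕜 V u a.1) a.2 ζ.2 :=
  mfderiv_prod_eq_add_apply (contMDiff_frameEval.mdifferentiableAt (by simp))

/-- Split a tangent vector of `F^λ(V) × F` into its two components. The image of the `F`-component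
is vertical in `V`, so `A` fixes it as `P × id` fixes the component itself; only the frame direction
imposes a condition. -/
theorem intertwines_iff (P : PrincipalConnection 𝕜 I F V)
    (A : Connection (I.prod 𝓘(ℝ, F)) I (TotalSpace.proj : TotalSpace F V → M)) :
    Intertwines P A ↔ ∀ p (ξ : TangentSpace (I.prod 𝓘(ℝ, F →L[𝕜] F)) p) u,
      mfderiv (I.prod 𝓘(ℝ, F →L[𝕜] F)) (I.prod 𝓘(ℝ, F)) (evalAt 𝕜 V u) p (P.vert p ξ) =
      A.vert (evalAt 𝕜 V u p)
        (mfderiv (I.prod 𝓘(ℝ, F →L[𝕜] F)) (I.prod 𝓘(ℝ, F)) (evalAt 𝕜 V u) p ξ) := by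
  constructor
  · intro h p ξ u
    have h1 : ∀ ξ : TangentSpace (I.prod 𝓘(ℝ, F →L[𝕜] F)) p,
        (mfderiv ((I.prod 𝓘(ℝ, F →L[𝕜] F)).prod 𝓘(ℝ, F)) (I.prod 𝓘(ℝ, F)) frameEval (p, u)
          ((ξ, (0 : F)) : (E × (F →L[𝕜] F)) × F) : E × F) =
        mfderiv (I.prod 𝓘(ℝ, F →L[𝕜] F)) (I.prod 𝓘(ℝ, F)) (evalAt 𝕜 V u) p ξ := fun ξ => by
      refine (mfderiv_frameEval_apply (I := I) (p, u)
        ((ξ, (0 : F)) : (E × (F →L[𝕜] F)) × F)).trans ?_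
      exact (congrArg _ (map_zero _)).trans (add_zero _)
    have h2 := tangentBundle_snd_eq (h ⟨(p, u), ((ξ, (0 : F)) : (E × (F →L[𝕜] F)) × F)⟩)
    exact ((h1 _).symm.trans h2.symm).trans (congrArg (A.vert (evalAt 𝕜 V u p)) (h1 ξ))
  · rintro h ⟨a, ζ⟩
    refine tangentBundle_mk_eq rfl ?_
    have hv : A.vert (frameEval a) (mfderiv 𝓘(ℝ, F) (I.prod 𝓘(ℝ, F))
        (fun u => evalAt 𝕜 V u a.1) a.2 ζ.2 : E × F) = (mfderiv 𝓘(ℝ, F) (I.prod 𝓘(ℝ, F))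
        (fun u => evalAt 𝕜 V u a.1) a.2 ζ.2 : E × F) := by
      refine A.vert_eq_self ?_
      refine (mfderiv_mfderiv_eq (h := fun _ => frameProj a.1) rfl
        ((contMDiff_proj V).mdifferentiableAt (n := ∞) (by simp))
        (((contMDiff_frameEval (I := I)).comp
          (contMDiff_const.prodMk contMDiff_id)).mdifferentiableAt (by simp))
        (Filter.Eventually.of_forall fun _ => rfl) ζ.2).trans ?_
      rw [mfderiv_const]
      rfl
    refine (congrArg (A.vert (frameEval a)) (mfderiv_frameEval_apply a ζ)).trans ?_
    refine ((A.vert (frameEval a)).map_add _ _).trans ?_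
    refine Eq.trans ?_ (mfderiv_frameEval_apply a (P.vertProd a ζ)).symm
    exact congrArg₂ (· + ·) (h a.1 ζ.1 a.2).symm hv

theorem AffineConnection.existsUnique_principal (A : AffineConnection 𝕜 I F V) :
    ∃! P : PrincipalConnection 𝕜 I F V, Intertwines P A.toConnection := by
  refine ⟨A.toPrincipal, (intertwines_iff _ _).2 A.mfderiv_evalAt_principalVert, fun P hP => ?_⟩
  have hP := (intertwines_iff _ _).1 hP
  ext p ξ
  exact frame_tangent_ext_evalAt fun u =>
    (hP p ξ u).trans (A.mfderiv_evalAt_principalVert p ξ u).symm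

/-! ### The canonical bijection -/

variable (𝕜 I F V) in
theorem existsUnique_connectionEquiv :
    ∃! Φ : AffineConnection 𝕜 I F V ≃ PrincipalConnection 𝕜 I F V,
      ∀ (P : PrincipalConnection 𝕜 I F V)
        (B : Connection (I.prod 𝓘(ℝ, F)) I (assocProj 𝕜 F V)),
        IsInduced P B → IsIdentified B (Φ.symm P) := by
  choose p hp hp' using fun A : AffineConnection 𝕜 I F V => A.existsUnique_principal
  choose a ha ha' using fun P : PrincipalConnection 𝕜 I F V => P.existsUnique_affine
  refine ⟨⟨p, a, fun A => (ha' _ A (hp A)).symm, fun P => (hp' _ P (ha P)).symm⟩,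
    fun P B hB => (hB.isIdentified_iff _).2 (ha P), fun Ψ hΨ => ?_⟩
  -- The condition constrains only the inverse, so the two bijections are compared through their
  -- inverses. Existence of the induced connection is needed next: without it the hypothesis on `Ψ`
  -- would be vacuous at `P`.
  refine Equiv.symm_bijective.injective (Equiv.ext fun P => ?_)
  obtain ⟨B, hB, -⟩ := P.existsUnique_isInduced
  exact ha' P _ ((hB.isIdentified_iff _).1 (hΨ P B hB))

end BundleMaps

end FrameConn

theorem mainTheorem5 {𝕜 : Type*} [RCLike 𝕜] (k : ℕ)
    {E : Type*} [NormedAddCommGroup E] [NormedSpace ℝ E] [FiniteDimensional ℝ E]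
    {H : Type*} [TopologicalSpace H] (I : ModelWithCorners ℝ E H) [I.Boundaryless]
    {M : Type*} [TopologicalSpace M] [ChartedSpace H M] [IsManifold I ∞ M]
    (V : M → Type*) [∀ x, AddCommGroup (V x)] [∀ x, Module 𝕜 (V x)] [∀ x, Module ℝ (V x)]
    [∀ x, IsScalarTower ℝ 𝕜 (V x)] [∀ x, TopologicalSpace (V x)]
    [∀ x, IsTopologicalAddGroup (V x)] [∀ x, ContinuousSMul 𝕜 (V x)]
    [∀ x, ContinuousSMul ℝ (V x)]
    [TopologicalSpace (TotalSpace (EuclideanSpace 𝕜 (Fin k)) V)]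
    [FiberBundle (EuclideanSpace 𝕜 (Fin k)) V]
    [VectorBundle 𝕜 (EuclideanSpace 𝕜 (Fin k)) V] [VectorBundle ℝ (EuclideanSpace 𝕜 (Fin k)) V]
    [ContMDiffVectorBundle ∞ (EuclideanSpace 𝕜 (Fin k)) V I] :
    let F := EuclideanSpace 𝕜 (Fin k)
    let J := I.prod 𝓘(ℝ, F →L[𝕜] F)
    let K := I.prod 𝓘(ℝ, F)
    -- the associated bundle is the quotient manifold of `F^λ(V) × F`
    (ContMDiff (J.prod 𝓘(ℝ, F)) K ∞ (assocMk : FrameBundle 𝕜 F V × F → AssocBundle 𝕜 F V) ∧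
      ∀ a : FrameBundle 𝕜 F V × F,
        Function.Surjective (mfderiv (J.prod 𝓘(ℝ, F)) K assocMk a)) ∧
    -- the natural identification of the associated bundle with `V` is a diffeomorphism
    (ContMDiff K K ∞ (assocHomeo 𝕜 F V) ∧ ContMDiff K K ∞ (assocHomeo 𝕜 F V).symm) ∧
    -- every principal connection induces exactly one connection on the associated bundle
    (∀ P : PrincipalConnection 𝕜 I F V, ∃! B : Connection K I (assocProj 𝕜 F V), IsInduced P B) ∧
    -- the canonical bijection, whose inverse is the induced connection
    ∃! Φ : AffineConnection 𝕜 I F V ≃ PrincipalConnection 𝕜 I F V,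
      ∀ (P : PrincipalConnection 𝕜 I F V) (B : Connection K I (assocProj 𝕜 F V)),
        IsInduced P B → IsIdentified B (Φ.symm P) := by
  intro F J K
  have hq := hasLocalSections_assocMk 𝕜 I F V
  exact ⟨⟨hq.smooth, hq.surjective_mfderiv⟩,
    ⟨contMDiff_assocHomeo 𝕜 F V, contMDiff_assocHomeo_symm 𝕜 F V⟩,
    fun P => P.existsUnique_isInduced, existsUnique_connectionEquiv 𝕜 I F V⟩
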